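/- All graphs and tournaments are finite. A \emph{3ECTF graph} is a finite triangle-free graph $G$ that is $3$-existentially complete: whenever $B\subseteq A\subseteq V(G)$, $|A|\le 3$ and $B$ is independent, there is a vertex adjacent to every vertex of $B$ and to no vertex of $A\setminus B$. A \emph{tournament} $T$ is an orientation of a complete graph; write $i\to i'$ for its arcs. Let $T_4$ be the tournament on $\{0,1,2,3\}$ with arcs $0\to1$, $0\to2$, $0\to3$, $1\to2$, $2\to3$, $3\to1$, and let $T_4'$ be obtained from $T_4$ by reversing all arcs. $T$ is \emph{shattered} if every three distinct vertices of $T$ lie in a four-vertex set that induces a copy of $T_4$ or of $T_4'$. Let $d$ be the Hamming distance on $\mathbb{Z}_2^n$, and for $n\ge2$ let $\tau(x_1,x_2,x_3,\dots,x_n)=(x_2,x_1+1,x_3,\dots,x_n)$. For $m,k\ge1$, let $C_{3k-1}(m)$ be the graph with vertices $(j,x)$, $1\le j\le m$, $x\in\mathbb{Z}_2^{3k-1}$, in which $(j,x)\sim(j,x')$ if and only if $d(x,x')\in\{2k-1,2k+1,2k+2,\dots,3k-1\}$, and, for $j\ne j'$, $(j,x)\sim(j',x')$ if and only if $d(x,x')\in\{2k,2k+1,\dots,3k-1\}$.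 For a tournament $T$, the twisted graph $G_T(m,k)$ has vertices $(i,j,x)$ with $i\in V(T)$, $1\le j\le m$, $x\in\mathbb{Z}_2^{3k-1}$. For each $i$, $(i,j,x)\sim(i,j',x')$ if and only if $(j,x)\sim(j',x')$ in $C_{3k-1}(m)$; and if $i\to i'$, then for all $j,j'$, $(i,j,x)\sim(i',j',x')$ if and only if $d(x,\tau(x'))\in\{2k,2k+1,\dots,3k-1\}$. \textbf{Proposition.} Let $m\ge2$ and $k\ge1$, and let $T$ be a shattered tournament with $|V(T)|\cdot m\ge4$ (since $m\ge 2$, this holds whenever $T$ has at least two vertices; it only excludes the empty tournament and, for $m\in\{2,3\}$, the one-vertex tournament). Then $G_T(m,k)$ is a 3ECTF graph. -/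

import Mathlib

/-- A tournament on `V`: an orientation of the complete graph on `V`.
`T.Adj i j` is the arc `i → j`. -/
structure Tournament (V : Type*) extends Digraph V where
  irrefl : ∀ i, ¬ Adj i i
  exactlyOne : ∀ i j, i ≠ j → (Adj i j ↔ ¬ Adj j i)

namespace Tournament

/-- The tournament obtained by reversing all arcs. -/
def reverse {V : Type*} (T : Tournament V) : Tournament V where
  Adj i j := T.Adj j i
  irrefl := T.irrefl
  exactlyOne i j h := T.exactlyOne j i h.symm

/-- The tournament `T₄` on `{0, 1, 2, 3}`: `0` beats the cyclic triangle `1 → 2 → 3 → 1`. -/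
def T4 : Tournament (Fin 4) where
  Adj i j := (i, j) ∈ ({(0, 1), (0, 2), (0, 3), (1, 2), (2, 3), (3, 1)} : Finset (Fin 4 × Fin 4))
  irrefl := by decide
  exactlyOne := by decide

/-- The tournament `T₄'`, obtained from `T₄` by reversing all arcs. -/
def T4' : Tournament (Fin 4) := T4.reverse

/-- `f` embeds `S` as an induced subtournament of `T`, i.e. its image is a copy of `S` in `T`. -/
def IsCopy {W V : Type*} (S : Tournament W) (T : Tournament V) (f : W ↪ V) : Prop :=
  ∀ a b, T.Adj (f a) (f b) ↔ S.Adj a b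

/-- Every three (distinct) vertices extend to a copy of `T₄` or of `T₄'`. -/
def IsShattered {V : Type*} (T : Tournament V) : Prop :=
  ∀ a b c : V, a ≠ b → a ≠ c → b ≠ c →
    ∃ f : Fin 4 ↪ V, (T4.IsCopy T f ∨ T4'.IsCopy T f) ∧
      a ∈ Set.range f ∧ b ∈ Set.range f ∧ c ∈ Set.range f

end Tournament

/-- `(E_k)`, `k`-existential completeness of a (triangle-free) graph: for all `B ⊆ A` with
`|A| ≤ k` and `B` independent, some vertex is adjacent to each vertex of `B` and to no vertex
of `A \ B`. -/
def SimpleGraph.IsExistentiallyComplete {V : Type*} (G : SimpleGraph V) (k : ℕ) : Prop :=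
  ∀ A B : Finset V, B ⊆ A → A.card ≤ k → G.IsIndepSet (B : Set V) →
    ∃ v, (∀ b ∈ B, G.Adj v b) ∧ ∀ a ∈ A, a ∉ B → ¬ G.Adj v a

/-- A 3ECTF graph: a finite `3`-existentially complete triangle-free graph. -/
structure SimpleGraph.Is3ECTF {V : Type*} (G : SimpleGraph V) : Prop where
  finite : Finite V
  triangleFree : G.CliqueFree 3
  existentiallyComplete : G.IsExistentiallyComplete 3

/-- The graph `C_{3k-1}(m)`: its vertices `(j, x)` form `m` copies of the cube `ℤ₂^{3k-1}`.
Within one copy, vertices are adjacent iff their Hamming distance is in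
`{2k-1, 2k+1, 2k+2, …, 3k-1}`; in different copies, iff it is in `{2k, 2k+1, …, 3k-1}`. -/
def hypercubeGraph (m k : ℕ) (hk : 1 ≤ k) :
    SimpleGraph (Fin m × (Fin (3 * k - 1) → ZMod 2)) where
  Adj p q :=
    (p.1 = q.1 ∧ hammingDist p.2 q.2 ∈ insert (2 * k - 1) (Finset.Icc (2 * k + 1) (3 * k - 1))) ∨
    (p.1 ≠ q.1 ∧ hammingDist p.2 q.2 ∈ Finset.Icc (2 * k) (3 * k - 1))
  symm := ⟨by
    intro p q h
    rw [hammingDist_comm q.2 p.2]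
    exact h.imp (fun h => ⟨h.1.symm, h.2⟩) (fun h => ⟨h.1.symm, h.2⟩)⟩
  loopless := ⟨by
    intro p h
    rcases h with ⟨-, h⟩ | ⟨h, -⟩
    · rw [hammingDist_self, Finset.mem_insert, Finset.mem_Icc] at h
      omega
    · exact h rfl⟩

/-- The twist `τ(x₁, x₂, x₃, …, xₙ) = (x₂, x₁ + 1, x₃, …, xₙ)` of `ℤ₂ⁿ`, `n ≥ 2`. -/
def twist {n : ℕ} (hn : 2 ≤ n) (x : Fin n → ZMod 2) : Fin n → ZMod 2 := fun i =>
  if i.val = 0 then x ⟨1, by omega⟩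
  else if i.val = 1 then x ⟨0, by omega⟩ + 1
  else x i

/-- The graph `G_T(m, k)`: its vertices are the `(i, j, x)` with `i` a vertex of `T`,
`j` one of `m` indices and `x ∈ ℤ₂^{3k-1}`. Each part `{i} × _ × _` is a copy of `C_{3k-1}(m)`,
and for `i → i'` the vertices `(i, j, x)`, `(i', j', x')` are adjacent iff
`d(x, τ(x')) ∈ {2k, …, 3k-1}`. -/
def twistedGraph {V : Type*} (T : Tournament V) (m k : ℕ) (hk : 1 ≤ k) :
    SimpleGraph (V × Fin m × (Fin (3 * k - 1) → ZMod 2)) where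
  Adj p q :=
    (p.1 = q.1 ∧ (hypercubeGraph m k hk).Adj p.2 q.2) ∨
    (T.Adj p.1 q.1 ∧
      hammingDist p.2.2 (twist (by omega) q.2.2) ∈ Finset.Icc (2 * k) (3 * k - 1)) ∨
    (T.Adj q.1 p.1 ∧
      hammingDist q.2.2 (twist (by omega) p.2.2) ∈ Finset.Icc (2 * k) (3 * k - 1))
  symm := ⟨by
    intro p q h
    rcases h with h | h | h
    · exact Or.inl ⟨h.1.symm, h.2.symm⟩
    · exact Or.inr (Or.inr h)
    · exact Or.inr (Or.inl h)⟩
  loopless := ⟨by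
    intro p h
    rcases h with h | h | h
    · exact (hypercubeGraph m k hk).irrefl h.2
    · exact T.irrefl _ h.1
    · exact T.irrefl _ h.1⟩

/-! Write n = 3k-1. A coordinate separates none or exactly two of the three pairs among three
points, so three pairwise distances have an even sum of at most 2n = 6k-2. Three adjacencies between
cubes in common coordinates would need the odd sum 6k-3 or a sum of at least 6k-1, so they cannot
form a triangle (`not_linked_triangle`). The same count shows that a vertex in a further copy can be
adjacent to both x and y only if d(x,y) ≤ 2k-2, and to exactly one only if x ≠ y. This is
`Compatible`, and for three points the pairwise conditions suffice (`exists_of_compatible`). If a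
pair fails them, the new vertex goes into one of the given copies, at distance 2k-1 or 2k from the
points there: these are the two distances whose roles are exchanged within a copy
(`exists_copy_linked`).

In the tournament, `frameShift` carries coordinates from one vertex to another. Over two vertices
these changes are consistent, and the untwisted argument applies. Over three vertices they are not:
the twist is a quarter turn of the 4-cycle formed by the first two coordinates, so the distance of
two points seen from a third vertex is their own distance plus or minus one (`hammingDist_flip`). A
triangle would still need a sum of 6k-1.

For completeness over three vertices, the new vertex may lie over any one of them from which the
other two points look compatible (`exists_adj_of_compatible`). If this fails for all three, an odd
number of the three distances has gone up. Shattering then supplies a fourth vertex from which every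
distance moves the opposite way (`headDist_flipLaw`), so that all pairs look compatible there
(`FlipLaw.compatible`). -/

/-! ### Coordinate classes of three points -/

/-- Three points of the cube split the coordinates into four classes, and a fourth point may be
chosen freely within each class. -/
theorem exists_hammingDist_triple {n : ℕ} (x y z : Fin n → ZMod 2) :
    ∃ a b c p : ℕ, a + b + c + p = n ∧ hammingDist x y = a + b ∧ hammingDist x z = a + c ∧
      hammingDist y z = b + c ∧
      ∀ a' b' c' p', a' ≤ a → b' ≤ b → c' ≤ c → p' ≤ p → ∃ v : Fin n → ZMod 2,
        hammingDist v x = a' + b' + c' + p' ∧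
        hammingDist v y = (a - a') + (b - b') + c' + p' ∧
        hammingDist v z = (a - a') + b' + (c - c') + p' := by
  classical
  have two : ∀ s t u : ZMod 2, t ≠ u ↔ (s = t ↔ s ≠ u) := by decide
  have succ_eq : ∀ s t : ZMod 2, s + 1 = t ↔ s ≠ t := by decide
  set A := Finset.univ.filter fun i => x i ≠ y i ∧ x i ≠ z i with hA
  set B := Finset.univ.filter fun i => x i ≠ y i ∧ x i = z i with hB
  set C := Finset.univ.filter fun i => x i = y i ∧ x i ≠ z i with hC
  set P := Finset.univ.filter fun i => x i = y i ∧ x i = z i with hP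
  have mA : ∀ i, i ∈ A ↔ x i ≠ y i ∧ x i ≠ z i := by simp [hA]
  have mB : ∀ i, i ∈ B ↔ x i ≠ y i ∧ x i = z i := by simp [hB]
  have mC : ∀ i, i ∈ C ↔ x i = y i ∧ x i ≠ z i := by simp [hC]
  have mP : ∀ i, i ∈ P ↔ x i = y i ∧ x i = z i := by simp [hP]
  have AB : Disjoint A B := Finset.disjoint_left.2 fun i => by rw [mA, mB]; tauto
  have AC : Disjoint A C := Finset.disjoint_left.2 fun i => by rw [mA, mC]; tauto
  have BC : Disjoint B C := Finset.disjoint_left.2 fun i => by rw [mB, mC]; tauto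
  have AP : Disjoint A P := Finset.disjoint_left.2 fun i => by rw [mA, mP]; tauto
  have BP : Disjoint B P := Finset.disjoint_left.2 fun i => by rw [mB, mP]; tauto
  have CP : Disjoint C P := Finset.disjoint_left.2 fun i => by rw [mC, mP]; tauto
  refine ⟨A.card, B.card, C.card, P.card, ?_, ?_, ?_, ?_, ?_⟩
  · rw [← Finset.card_union_of_disjoint AB,
      ← Finset.card_union_of_disjoint (Finset.disjoint_union_left.2 ⟨AC, BC⟩),
      ← Finset.card_union_of_disjoint
        (Finset.disjoint_union_left.2 ⟨Finset.disjoint_union_left.2 ⟨AP, BP⟩, CP⟩)]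
    convert Finset.card_fin n
    ext i
    simp only [Finset.mem_union, mA, mB, mC, mP, Finset.mem_univ, iff_true]
    tauto
  · rw [← Finset.card_union_of_disjoint AB, hammingDist]
    congr 1
    ext i
    simp only [Finset.mem_filter, Finset.mem_univ, true_and, Finset.mem_union, mA, mB]
    tauto
  · rw [← Finset.card_union_of_disjoint AC, hammingDist]
    congr 1
    ext i
    simp only [Finset.mem_filter, Finset.mem_univ, true_and, Finset.mem_union, mA, mC]
    tauto
  · rw [← Finset.card_union_of_disjoint BC, hammingDist]
    congr 1
    ext i
    simp only [Finset.mem_filter, Finset.mem_univ, true_and, Finset.mem_union, mB, mC]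
    rw [two (x i) (y i) (z i)]
    tauto
  · intro a' b' c' p' ha hb hc hp
    obtain ⟨A', hA', rfl⟩ := Finset.exists_subset_card_eq ha
    obtain ⟨B', hB', rfl⟩ := Finset.exists_subset_card_eq hb
    obtain ⟨C', hC', rfl⟩ := Finset.exists_subset_card_eq hc
    obtain ⟨P', hP', rfl⟩ := Finset.exists_subset_card_eq hp
    rw [← Finset.card_sdiff_of_subset hA', ← Finset.card_sdiff_of_subset hB',
      ← Finset.card_sdiff_of_subset hC']
    have card4 : ∀ {A₁ B₁ C₁ P₁ : Finset (Fin n)}, A₁ ⊆ A → B₁ ⊆ B → C₁ ⊆ C → P₁ ⊆ P →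
        (A₁ ∪ B₁ ∪ C₁ ∪ P₁).card = A₁.card + B₁.card + C₁.card + P₁.card := by
      intro A₁ B₁ C₁ P₁ h1 h2 h3 h4
      rw [Finset.card_union_of_disjoint (Finset.disjoint_union_left.2
          ⟨Finset.disjoint_union_left.2 ⟨AP.mono h1 h4, BP.mono h2 h4⟩, CP.mono h3 h4⟩),
        Finset.card_union_of_disjoint (Finset.disjoint_union_left.2
          ⟨AC.mono h1 h3, BC.mono h2 h3⟩),
        Finset.card_union_of_disjoint (AB.mono h1 h2)]
    refine ⟨fun i => if i ∈ A' ∪ B' ∪ C' ∪ P' then x i + 1 else x i, ?_, ?_, ?_⟩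
    · rw [← card4 hA' hB' hC' hP', hammingDist]
      congr 1
      ext i
      by_cases h : i ∈ A' ∪ B' ∪ C' ∪ P' <;> simp only [Finset.mem_filter, h] <;> simp
    · rw [← card4 Finset.sdiff_subset Finset.sdiff_subset hC' hP', hammingDist]
      congr 1
      ext i
      have hv : (if i ∈ A' ∪ B' ∪ C' ∪ P' then x i + 1 else x i) ≠ y i ↔
          (i ∈ A' ∪ B' ∪ C' ∪ P' ↔ x i = y i) := by
        split_ifs with h
        · rw [ne_eq, succ_eq, not_not, iff_true_left h]
        · rw [ne_eq, iff_false_left h]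
      rw [Finset.mem_filter, hv]
      by_cases h : x i = y i
      · have hA'' : i ∉ A := fun h' => ((mA i).1 h').1 h
        have hB'' : i ∉ B := fun h' => ((mB i).1 h').1 h
        have h1 : i ∉ A' := fun h' => hA'' (hA' h')
        have h2 : i ∉ B' := fun h' => hB'' (hB' h')
        simp [h, h1, h2, hA'', hB'']
      · have hC'' : i ∉ C' := fun h' => h ((mC i).1 (hC' h')).1
        have hP'' : i ∉ P' := fun h' => h ((mP i).1 (hP' h')).1
        have hAB : i ∈ A ∨ i ∈ B := by
          rw [mA, mB]
          tauto
        have hA'' : i ∈ A → i ∉ B := fun h1 => Finset.disjoint_left.1 AB h1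
        have h1 : i ∈ A' → i ∈ A := @hA' i
        have h2 : i ∈ B' → i ∈ B := @hB' i
        simp only [Finset.mem_univ, true_and, Finset.mem_union, Finset.mem_sdiff, h, hC'', hP'']
        clear * - hAB hA'' h1 h2
        tauto
    · rw [← card4 Finset.sdiff_subset hB' Finset.sdiff_subset hP', hammingDist]
      congr 1
      ext i
      have hv : (if i ∈ A' ∪ B' ∪ C' ∪ P' then x i + 1 else x i) ≠ z i ↔
          (i ∈ A' ∪ B' ∪ C' ∪ P' ↔ x i = z i) := by
        split_ifs with h
        · rw [ne_eq, succ_eq, not_not, iff_true_left h]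
        · rw [ne_eq, iff_false_left h]
      rw [Finset.mem_filter, hv]
      by_cases h : x i = z i
      · have hA'' : i ∉ A := fun h' => ((mA i).1 h').2 h
        have hC'' : i ∉ C := fun h' => ((mC i).1 h').2 h
        have h1 : i ∉ A' := fun h' => hA'' (hA' h')
        have h2 : i ∉ C' := fun h' => hC'' (hC' h')
        simp [h, h1, h2, hA'', hC'']
      · have hB'' : i ∉ B' := fun h' => h ((mB i).1 (hB' h')).2
        have hP'' : i ∉ P' := fun h' => h ((mP i).1 (hP' h')).2
        have hAB : i ∈ A ∨ i ∈ C := by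
          rw [mA, mC]
          tauto
        have hA'' : i ∈ A → i ∉ C := fun h1 => Finset.disjoint_left.1 AC h1
        have h1 : i ∈ A' → i ∈ A := @hA' i
        have h2 : i ∈ C' → i ∈ C := @hC' i
        simp only [Finset.mem_univ, true_and, Finset.mem_union, Finset.mem_sdiff, h, hB'', hP'']
        clear * - hAB hA'' h1 h2
        tauto

/-! ### Points of one cube at prescribed distances -/

/-- The adjacency condition of `hypercubeGraph` for two vertices at distance `d`, where `s` says
that they are in the same copy of the cube. -/
def Linked (k : ℕ) (s : Prop) (d : ℕ) : Prop :=
  (s ∧ (d = 2 * k - 1 ∨ 2 * k + 1 ≤ d)) ∨ (¬ s ∧ 2 * k ≤ d)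

theorem linked_of_same {k d : ℕ} {s : Prop} (h : s) :
    Linked k s d ↔ d = 2 * k - 1 ∨ 2 * k + 1 ≤ d := by
  simp [Linked, h]

theorem linked_of_ne {k d : ℕ} {s : Prop} (h : ¬ s) : Linked k s d ↔ 2 * k ≤ d := by
  simp [Linked, h]

/-- The condition on the distance of two points under which a point in a further copy of the cube
can have prescribed adjacencies `b`, `b'` to them. -/
def Compatible (k : ℕ) (b b' : Prop) (d : ℕ) : Prop :=
  (b → b' → d ≤ 2 * k - 2) ∧ (b → ¬ b' → 1 ≤ d) ∧ (¬ b → b' → 1 ≤ d)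

theorem Compatible.symm {k d : ℕ} {b b' : Prop} (h : Compatible k b b' d) :
    Compatible k b' b d :=
  ⟨fun h₁ h₂ => h.1 h₂ h₁, fun h₁ h₂ => h.2.2 h₂ h₁, fun h₁ h₂ => h.2.1 h₂ h₁⟩

section Cube

variable {k : ℕ} (x y z : Fin (3 * k - 1) → ZMod 2)

theorem exists_far_far_far (hk : 1 ≤ k) (hxy : hammingDist x y ≤ 2 * k - 2)
    (hxz : hammingDist x z ≤ 2 * k - 2) (hyz : hammingDist y z ≤ 2 * k - 2) :
    ∃ v, 2 * k ≤ hammingDist v x ∧ 2 * k ≤ hammingDist v y ∧ 2 * k ≤ hammingDist v z := by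
  obtain ⟨a, d, c, p, hn, h₁, h₂, h₃, H⟩ := exists_hammingDist_triple x y z
  -- Being far from a point means agreeing with it in at most k-1 coordinates. The point v opposes
  -- all three on the common class, and sides with the odd point in up to k-1 coordinates of each
  -- other class.
  obtain ⟨v, hx, hy, hz⟩ := H (a - (k - 1)) (min d (k - 1)) (min c (k - 1)) p
    (by omega) (by omega) (by omega) le_rfl
  exact ⟨v, by omega, by omega, by omega⟩

theorem exists_far_far_near (hk : 1 ≤ k) (hxy : hammingDist x y ≤ 2 * k - 2)
    (hxz : 1 ≤ hammingDist x z) (hyz : 1 ≤ hammingDist y z) :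
    ∃ v, 2 * k ≤ hammingDist v x ∧ 2 * k ≤ hammingDist v y ∧ ¬ 2 * k ≤ hammingDist v z := by
  obtain ⟨a, d, c, p, hn, h₁, h₂, h₃, H⟩ := exists_hammingDist_triple x y z
  -- On the class where z is the odd point v sides with z, which helps all three requirements.
  suffices h : ∃ A B P, A ≤ a ∧ B ≤ d ∧ P ≤ p ∧ 2 * k ≤ A + B + c + P ∧
      2 * k ≤ (a - A) + (d - B) + c + P ∧ (a - A) + B + (c - c) + P < 2 * k by
    obtain ⟨A, B, P, hA, hB, hP, hx, hy, hz⟩ := h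
    obtain ⟨v, hx', hy', hz'⟩ := H A B c P hA hB le_rfl hP
    exact ⟨v, by omega, by omega, by omega⟩
  clear H
  -- With P common coordinates opposed, v must differ from each of x and y in at least q coordinates
  -- of the first two classes. P stays below 2k since v is to be near z; for c = 0 it stops at 2k-1,
  -- and q = 1 makes up the difference.
  obtain ⟨P, hP, q, hq⟩ : ∃ P ≤ p, ∃ q, 2 * k ≤ q + c + P ∧ 2 * q ≤ a + d ∧ P < 2 * k ∧
      P + q < 2 * k + a ∧ P + q < 2 * k + d := by
    rcases le_total (2 * k - max c 1) p with h | h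
    · exact ⟨2 * k - max c 1, h, if c = 0 then 1 else 0, by split_ifs <;> omega⟩
    · exact ⟨p, le_rfl, 2 * k - c - p, by omega⟩
  rcases le_total q d with h | h
  · rcases le_total q a with h' | h'
    · exact ⟨a, 0, P, by omega⟩
    · exact ⟨a, q - a, P, by omega⟩
  · exact ⟨a + d - q, 0, P, by omega⟩

theorem exists_far_near_near (hk : 1 ≤ k) (hxy : 1 ≤ hammingDist x y)
    (hxz : 1 ≤ hammingDist x z) :
    ∃ v, 2 * k ≤ hammingDist v x ∧ ¬ 2 * k ≤ hammingDist v y ∧ ¬ 2 * k ≤ hammingDist v z := by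
  obtain ⟨a, d, c, p, hn, h₁, h₂, h₃, H⟩ := exists_hammingDist_triple x y z
  -- Differing from x where x is the odd point costs nothing at y and z. The second class counts
  -- towards d(v,z) and the third towards d(v,y), hence the caps 2k-1.
  obtain ⟨v, hx, hy, hz⟩ := H a (min d (2 * k - 1)) (min c (2 * k - 1))
    (2 * k - a - min d (2 * k - 1) - min c (2 * k - 1)) le_rfl (by omega) (by omega) (by omega)
  exact ⟨v, by omega, by omega, by omega⟩

theorem exists_near_near_near (hk : 1 ≤ k) :
    ∃ v, ¬ 2 * k ≤ hammingDist v x ∧ ¬ 2 * k ≤ hammingDist v y ∧ ¬ 2 * k ≤ hammingDist v z := by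
  obtain ⟨a, d, c, p, hn, h₁, h₂, h₃, H⟩ := exists_hammingDist_triple x y z
  -- v follows the majority of the three points, except beyond 2k-1 coordinates of a class.
  obtain ⟨v, hx, hy, hz⟩ := H (min a (2 * k - 1)) (d - (2 * k - 1)) (c - (2 * k - 1)) 0
    (by omega) (by omega) (by omega) (by omega)
  exact ⟨v, by omega, by omega, by omega⟩

theorem exists_of_compatible (hk : 1 ≤ k) (b₁ b₂ b₃ : Prop)
    (hxy : Compatible k b₁ b₂ (hammingDist x y)) (hxz : Compatible k b₁ b₃ (hammingDist x z))
    (hyz : Compatible k b₂ b₃ (hammingDist y z)) :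
    ∃ v, (2 * k ≤ hammingDist v x ↔ b₁) ∧ (2 * k ≤ hammingDist v y ↔ b₂) ∧
      (2 * k ≤ hammingDist v z ↔ b₃) := by
  have hyx := hammingDist_comm y x
  have hzx := hammingDist_comm z x
  have hzy := hammingDist_comm z y
  unfold Compatible at *
  by_cases h₁ : b₁ <;> by_cases h₂ : b₂ <;> by_cases h₃ : b₃ <;>
    simp only [h₁, h₂, h₃, true_implies, false_implies, and_true, true_and, not_true_eq_false,
      not_false_eq_true, iff_true, iff_false] at *
  · exact exists_far_far_far x y z hk hxy hxz hyz
  · exact exists_far_far_near x y z hk hxy hxz hyz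
  · obtain ⟨v, h⟩ := exists_far_far_near x z y hk hxz hxy (by omega)
    exact ⟨v, h.1, h.2.2, h.2.1⟩
  · exact exists_far_near_near x y z hk hxy hxz
  · obtain ⟨v, h⟩ := exists_far_far_near y z x hk hyz (by omega) (by omega)
    exact ⟨v, h.2.2, h.1, h.2.1⟩
  · obtain ⟨v, h⟩ := exists_far_near_near y x z hk (by omega) hyz
    exact ⟨v, h.2.1, h.1, h.2.2⟩
  · obtain ⟨v, h⟩ := exists_far_near_near z x y hk (by omega) (by omega)
    exact ⟨v, h.2.1, h.2.2, h.1⟩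
  · exact exists_near_near_near x y z hk

/-- The distances among x, y, v add up to the maximum 2n, so v opposes x and y wherever they agree.
The only freedom is which k-1 of the other 2k-1 coordinates of x to change; these are chosen to make
z as far or as near as possible. -/
theorem exists_of_dist_eq_two_mul_sub_one (hk : 1 ≤ k) (b : Prop)
    (hxy : hammingDist x y = 2 * k - 1) (hxz : b → hammingDist x z ≤ 2 * k - 1)
    (hyz : Compatible k True b (hammingDist y z)) :
    ∃ v, hammingDist v x = 2 * k - 1 ∧ hammingDist v y = 2 * k ∧
      (2 * k ≤ hammingDist v z ↔ b) := by
  obtain ⟨a, d, c, p, hn, h₁, h₂, h₃, H⟩ := exists_hammingDist_triple x y z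
  unfold Compatible at hyz
  by_cases h : b
  · simp only [h, true_implies, iff_true] at *
    obtain ⟨v, hx, hy, hz⟩ := H (k - 1 - min d (k - 1)) (min d (k - 1)) c p
      (by omega) (by omega) le_rfl le_rfl
    exact ⟨v, by omega, by omega, by omega⟩
  · simp only [h, not_false_eq_true, true_implies, iff_false] at *
    obtain ⟨v, hx, hy, hz⟩ := H (min a (k - 1)) (k - 1 - min a (k - 1)) c p
      (by omega) (by omega) le_rfl le_rfl
    exact ⟨v, by omega, by omega, by omega⟩

theorem exists_dist_eq_two_mul_sub_one (hk : 1 ≤ k) (b : Prop)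
    (hxz : b → 1 ≤ hammingDist x z ∧ hammingDist x z ≤ 2 * k - 1) :
    ∃ v, hammingDist v x = 2 * k - 1 ∧ (2 * k ≤ hammingDist v z ↔ b) := by
  -- Repeating x empties the first two classes.
  obtain ⟨a, d, c, p, hn, h₁, h₂, h₃, H⟩ := exists_hammingDist_triple x x z
  rw [hammingDist_self] at h₁
  by_cases h : b
  · simp only [h, true_implies, iff_true] at *
    obtain ⟨v, hx, hy, hz⟩ := H 0 0 (2 * k - 1 - min p (2 * k - 1)) (min p (2 * k - 1))
      (by omega) (by omega) (by omega) (by omega)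
    exact ⟨v, by omega, by omega⟩
  · simp only [h, iff_false] at *
    obtain ⟨v, hx, hy, hz⟩ := H 0 0 (min c (2 * k - 1)) (2 * k - 1 - min c (2 * k - 1))
      (by omega) (by omega) (by omega) (by omega)
    exact ⟨v, by omega, by omega⟩

theorem exists_dist_eq_two_mul (hk : 1 ≤ k) (b : Prop)
    (hxz : Compatible k True b (hammingDist x z)) :
    ∃ v, hammingDist v x = 2 * k ∧ (2 * k ≤ hammingDist v z ↔ b) := by
  obtain ⟨a, d, c, p, hn, h₁, h₂, h₃, H⟩ := exists_hammingDist_triple x x z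
  rw [hammingDist_self] at h₁
  unfold Compatible at hxz
  by_cases h : b
  · simp only [h, true_implies, iff_true] at *
    obtain ⟨v, hx, hy, hz⟩ := H 0 0 (2 * k - min p (2 * k)) (min p (2 * k))
      (by omega) (by omega) (by omega) (by omega)
    exact ⟨v, by omega, by omega⟩
  · simp only [h, not_false_eq_true, true_implies, iff_false] at *
    obtain ⟨v, hx, hy, hz⟩ := H 0 0 (min c (2 * k)) (2 * k - min c (2 * k))
      (by omega) (by omega) (by omega) (by omega)
    exact ⟨v, by omega, by omega⟩

/-- `v` is taken in the copy of `x`, or in a copy different from those of `x`, `y`, `z`. -/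
theorem exists_linked_of_compatible (hk : 1 ≤ k) (b₁ b₂ b₃ : Prop)
    (hxy : b₁ → b₂ → hammingDist x y ≤ 2 * k - 1) (hxz : b₁ → b₃ → hammingDist x z ≤ 2 * k - 1)
    (hyz : Compatible k b₂ b₃ (hammingDist y z)) :
    ∃ (s : Prop) (v : _), (Linked k s (hammingDist v x) ↔ b₁) ∧
      (2 * k ≤ hammingDist v y ↔ b₂) ∧ (2 * k ≤ hammingDist v z ↔ b₃) := by
  -- Incompatibility leaves two cases: both adjacencies are wanted at distance 2k-1, or just one is
  -- wanted and x = y. In the copy of x, distance 2k-1 means adjacent and 2k means nonadjacent, the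
  -- reverse of the rule between copies, so v is placed there at one of these distances from x.
  have key : ∀ (y z : Fin (3 * k - 1) → ZMod 2) (b₂ b₃ : Prop),
      (b₁ → b₂ → hammingDist x y ≤ 2 * k - 1) → (b₁ → b₃ → hammingDist x z ≤ 2 * k - 1) →
      Compatible k b₂ b₃ (hammingDist y z) → ¬ Compatible k b₁ b₂ (hammingDist x y) →
      ∃ (s : Prop) (v : _), (Linked k s (hammingDist v x) ↔ b₁) ∧
        (2 * k ≤ hammingDist v y ↔ b₂) ∧ (2 * k ≤ hammingDist v z ↔ b₃) := by
    intro y z b₂ b₃ hxy hxz hyz h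
    by_cases h₁ : b₁ <;> by_cases h₂ : b₂ <;>
      simp only [Compatible, h₁, h₂, true_implies, false_implies, and_true, true_and,
        not_true_eq_false, not_false_eq_true] at hxy hxz h
    · obtain ⟨v, hx, hy, hz⟩ := exists_of_dist_eq_two_mul_sub_one x y z hk b₃ (by omega) hxz
        (by simpa [h₂] using hyz)
      exact ⟨True, v, by simp [Linked, hx, h₁], by simp [hy, h₂], hz⟩
    · obtain rfl : x = y := hammingDist_eq_zero.1 (by omega)
      obtain ⟨v, hx, hz⟩ := exists_dist_eq_two_mul_sub_one x z hk b₃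
        fun h₃ => ⟨hyz.2.2 h₂ h₃, hxz h₃⟩
      exact ⟨True, v, by simp [Linked, hx, h₁], by simp [hx, h₂]; omega, hz⟩
    · obtain rfl : x = y := hammingDist_eq_zero.1 (by omega)
      obtain ⟨v, hx, hz⟩ := exists_dist_eq_two_mul x z hk b₃ (by simpa [h₂] using hyz)
      exact ⟨True, v, by simp [Linked, hx, h₁]; omega, by simp [hx, h₂], hz⟩
  by_cases h₁ : Compatible k b₁ b₂ (hammingDist x y)
  · by_cases h₂ : Compatible k b₁ b₃ (hammingDist x z)
    · obtain ⟨v, hx, hy, hz⟩ := exists_of_compatible x y z hk b₁ b₂ b₃ h₁ h₂ hyz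
      exact ⟨False, v, by simpa [Linked] using hx, hy, hz⟩
    · obtain ⟨s, v, hx, hz, hy⟩ := key z y b₃ b₂ hxz hxy
        (by rw [hammingDist_comm]; exact hyz.symm) h₂
      exact ⟨s, v, hx, hy, hz⟩
  · exact key y z b₂ b₃ hxy hxz hyz h₁

/-- The distances among x, y, v again reach the maximum 2n. The witnesses are extreme: d(v,z) is
4k-1 minus d(x,z) or d(y,z) if b holds, and 2k-1 minus d(x,z) or d(y,z) otherwise. -/
theorem exists_of_dist_eq_two_mul (hk : 1 ≤ k) (b : Prop) (hxy : hammingDist x y = 2 * k)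
    (hxz : b → hammingDist x z ≤ 2 * k - 1) (hyz : b → hammingDist y z ≤ 2 * k - 1) :
    ∃ v, hammingDist v x = 2 * k - 1 ∧ hammingDist v y = 2 * k - 1 ∧
      (2 * k ≤ hammingDist v z ↔ b) := by
  obtain ⟨a, d, c, p, hn, h₁, h₂, h₃, H⟩ := exists_hammingDist_triple x y z
  by_cases h : b
  · simp only [h, true_implies, iff_true] at *
    rcases le_total d k with hd | hd
    · obtain ⟨v, hx, hy, hz⟩ := H (k - d) d c p (by omega) le_rfl le_rfl le_rfl
      exact ⟨v, by omega, by omega, by omega⟩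
    · obtain ⟨v, hx, hy, hz⟩ := H 0 k c p (by omega) hd le_rfl le_rfl
      exact ⟨v, by omega, by omega, by omega⟩
  · simp only [h, iff_false] at *
    rcases le_total a k with ha | ha
    · obtain ⟨v, hx, hy, hz⟩ := H a (k - a) c p le_rfl (by omega) le_rfl le_rfl
      exact ⟨v, by omega, by omega, by omega⟩
    · obtain ⟨v, hx, hy, hz⟩ := H k 0 c p ha (by omega) le_rfl le_rfl
      exact ⟨v, by omega, by omega, by omega⟩

/-- The extreme witnesses for z in another copy serve here too. If b holds, d(v,z) is 4k-1 minus
d(x,z) or d(y,z), and the bad value 2k would need that distance to be the adjacent value 2k-1. If b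
fails, d(v,z) is 2k-1 minus one of these positive distances, hence below 2k-1. -/
theorem exists_linked_same_of_dist_eq_two_mul (hk : 1 ≤ k) (b : Prop)
    (hxy : hammingDist x y = 2 * k) (hxz : b → ¬ Linked k True (hammingDist x z))
    (hyz : b → ¬ Linked k True (hammingDist y z))
    (hxz' : ¬ b → 1 ≤ hammingDist x z) (hyz' : ¬ b → 1 ≤ hammingDist y z) :
    ∃ v, hammingDist v x = 2 * k - 1 ∧ hammingDist v y = 2 * k - 1 ∧
      (Linked k True (hammingDist v z) ↔ b) := by
  obtain ⟨a, d, c, p, hn, h₁, h₂, h₃, H⟩ := exists_hammingDist_triple x y z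
  simp only [linked_of_same trivial] at *
  by_cases h : b
  · simp only [h, true_implies, iff_true] at *
    rcases le_total d k with hd | hd
    · obtain ⟨v, hx, hy, hz⟩ := H (k - d) d c p (by omega) le_rfl le_rfl le_rfl
      exact ⟨v, by omega, by omega, by omega⟩
    · obtain ⟨v, hx, hy, hz⟩ := H 0 k c p (by omega) hd le_rfl le_rfl
      exact ⟨v, by omega, by omega, by omega⟩
  · simp only [h, iff_false, not_false_eq_true, true_implies] at *
    rcases le_total a k with ha | ha
    · obtain ⟨v, hx, hy, hz⟩ := H a (k - a) c p le_rfl (by omega) le_rfl le_rfl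
      exact ⟨v, by omega, by omega, by omega⟩
    · obtain ⟨v, hx, hy, hz⟩ := H k 0 c p ha (by omega) le_rfl le_rfl
      exact ⟨v, by omega, by omega, by omega⟩

end Cube

/-! ### Three vertices in several copies of the cube -/

section Copies

variable {k : ℕ} {C : Type*} {c₁ c₂ c₃ f : C} {x y z : Fin (3 * k - 1) → ZMod 2} {b₁ b₂ b₃ : Prop}

theorem exists_copy_linked_of_compatible (hk : 1 ≤ k) (h₁₂ : c₁ ≠ c₂) (h₁₃ : c₁ ≠ c₃)
    (hf₁ : f ≠ c₁) (hf₂ : f ≠ c₂) (hf₃ : f ≠ c₃)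
    (hxy : b₁ → b₂ → hammingDist x y ≤ 2 * k - 1) (hxz : b₁ → b₃ → hammingDist x z ≤ 2 * k - 1)
    (hyz : Compatible k b₂ b₃ (hammingDist y z)) :
    ∃ c v, (c = c₁ ∨ c = f) ∧ (Linked k (c = c₁) (hammingDist v x) ↔ b₁) ∧
      (Linked k (c = c₂) (hammingDist v y) ↔ b₂) ∧
      (Linked k (c = c₃) (hammingDist v z) ↔ b₃) := by
  obtain ⟨s, v, hx, hy, hz⟩ := exists_linked_of_compatible x y z hk b₁ b₂ b₃ hxy hxz hyz
  by_cases hs : s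
  · refine ⟨c₁, v, Or.inl rfl, ?_, ?_, ?_⟩
    · simpa [hs] using hx
    · rwa [linked_of_ne h₁₂]
    · rwa [linked_of_ne h₁₃]
  · refine ⟨f, v, Or.inr rfl, ?_, ?_, ?_⟩
    · simpa [hs, hf₁] using hx
    · rwa [linked_of_ne hf₂]
    · rwa [linked_of_ne hf₃]

theorem exists_copy_linked_of_pairwise_ne (hk : 1 ≤ k) (h₁₂ : c₁ ≠ c₂) (h₁₃ : c₁ ≠ c₃)
    (h₂₃ : c₂ ≠ c₃) (hf₁ : f ≠ c₁) (hf₂ : f ≠ c₂) (hf₃ : f ≠ c₃)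
    (hxy : b₁ → b₂ → hammingDist x y ≤ 2 * k - 1) (hxz : b₁ → b₃ → hammingDist x z ≤ 2 * k - 1)
    (hyz : b₂ → b₃ → hammingDist y z ≤ 2 * k - 1) :
    ∃ c v, (c = c₁ ∨ c = c₂ ∨ c = c₃ ∨ c = f) ∧
      (Linked k (c = c₁) (hammingDist v x) ↔ b₁) ∧
      (Linked k (c = c₂) (hammingDist v y) ↔ b₂) ∧
      (Linked k (c = c₃) (hammingDist v z) ↔ b₃) := by
  have eyx := hammingDist_comm y x
  have ezx := hammingDist_comm z x
  have ezy := hammingDist_comm z y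
  by_cases hyz' : Compatible k b₂ b₃ (hammingDist y z)
  · obtain ⟨c, v, hc, hx, hy, hz⟩ :=
      exists_copy_linked_of_compatible hk h₁₂ h₁₃ hf₁ hf₂ hf₃ hxy hxz hyz'
    exact ⟨c, v, by clear * - hc; tauto, hx, hy, hz⟩
  by_cases hxz' : Compatible k b₁ b₃ (hammingDist x z)
  · obtain ⟨c, v, hc, hy, hx, hz⟩ := exists_copy_linked_of_compatible hk h₁₂.symm h₂₃ hf₂ hf₁ hf₃
      (fun h h' => eyx.trans_le (hxy h' h)) hyz hxz'
    exact ⟨c, v, by clear * - hc; tauto, hx, hy, hz⟩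
  by_cases hxy' : Compatible k b₁ b₂ (hammingDist x y)
  · obtain ⟨c, v, hc, hz, hx, hy⟩ := exists_copy_linked_of_compatible hk h₁₃.symm h₂₃.symm hf₃ hf₁
      hf₂ (fun h h' => ezx.trans_le (hxz h' h)) (fun h h' => ezy.trans_le (hyz h' h)) hxy'
    exact ⟨c, v, by clear * - hc; tauto, hx, hy, hz⟩
  -- If all three adjacencies are wanted, all distances equal 2k-1, with odd sum. If two are, the
  -- third point coincides with both, so these two are at distance 0 and hence compatible. If at
  -- most one is, a pair of unwanted ones is compatible.
  exfalso
  obtain ⟨a, b, c, p, hn, h₁, h₂, h₃, -⟩ := exists_hammingDist_triple x y z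
  unfold Compatible at *
  by_cases hb₁ : b₁ <;> by_cases hb₂ : b₂ <;> by_cases hb₃ : b₃ <;>
    simp only [hb₁, hb₂, hb₃, true_implies, false_implies, and_true, true_and,
      not_true_eq_false, not_false_eq_true] at * <;> omega

theorem exists_copy_linked_of_eq_of_ne (hk : 1 ≤ k) (h₁₃ : c₁ ≠ c₃) (hf₁ : f ≠ c₁) (hf₃ : f ≠ c₃)
    (hxy : b₁ → b₂ → ¬ Linked k True (hammingDist x y)) (hxz : b₁ → b₃ → hammingDist x z ≤ 2 * k - 1)
    (hyz : b₂ → b₃ → hammingDist y z ≤ 2 * k - 1) (hxy' : ¬ (b₁ ↔ b₂) → x ≠ y) :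
    ∃ c v, (c = c₁ ∨ c = c₃ ∨ c = f) ∧ (Linked k (c = c₁) (hammingDist v x) ↔ b₁) ∧
      (Linked k (c = c₁) (hammingDist v y) ↔ b₂) ∧
      (Linked k (c = c₃) (hammingDist v z) ↔ b₃) := by
  rw [← hammingDist_ne_zero] at hxy'
  by_cases h : Compatible k b₁ b₂ (hammingDist x y)
  · obtain ⟨c, v, hc, hz, hx, hy⟩ := exists_copy_linked_of_compatible hk h₁₃.symm h₁₃.symm hf₃ hf₁
      hf₁ (fun h h' => (hammingDist_comm z x).trans_le (hxz h' h))
      (fun h h' => (hammingDist_comm z y).trans_le (hyz h' h)) h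
    exact ⟨c, v, by clear * - hc; tauto, hx, hy, hz⟩
  · by_cases hb₁ : b₁ <;> by_cases hb₂ : b₂ <;>
      simp only [Compatible, linked_of_same trivial, hb₁, hb₂, true_implies, false_implies,
        and_true, true_and, not_true_eq_false, not_false_eq_true, iff_true, iff_false] at *
    · obtain ⟨v, hx, hy, hz⟩ := exists_of_dist_eq_two_mul x y z hk b₃ (by omega) hxz hyz
      exact ⟨c₁, v, Or.inl rfl, by simp [Linked, hx], by simp [Linked, hy],
        by rwa [linked_of_ne h₁₃]⟩
    · omega
    · omega

theorem exists_copy_linked_of_eq_of_dist_eq (hk : 1 ≤ k) (h₁ : b₁) (h₂ : b₂)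
    (h : hammingDist x y = 2 * k) (hxz : b₃ → ¬ Linked k True (hammingDist x z))
    (hyz : b₃ → ¬ Linked k True (hammingDist y z))
    (hxz' : ¬ b₃ → x ≠ z) (hyz' : ¬ b₃ → y ≠ z) :
    ∃ v, (Linked k True (hammingDist v x) ↔ b₁) ∧ (Linked k True (hammingDist v y) ↔ b₂) ∧
      (Linked k True (hammingDist v z) ↔ b₃) := by
  obtain ⟨v, hx, hy, hz⟩ := exists_linked_same_of_dist_eq_two_mul x y z hk b₃ h hxz hyz
    (fun h => Nat.one_le_iff_ne_zero.2 (hammingDist_ne_zero.2 (hxz' h)))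
    (fun h => Nat.one_le_iff_ne_zero.2 (hammingDist_ne_zero.2 (hyz' h)))
  exact ⟨v, by simp [Linked, hx, h₁], by simp [Linked, hy, h₂], hz⟩

/-- 2k is the only distance above 2k-2 at which two points of one copy are nonadjacent. -/
theorem dist_eq_of_not_compatible (h : ¬ Compatible k b₁ b₂ (hammingDist x y))
    (hxy : b₁ → b₂ → ¬ Linked k True (hammingDist x y)) (hxy' : ¬ (b₁ ↔ b₂) → x ≠ y) :
    b₁ ∧ b₂ ∧ hammingDist x y = 2 * k := by
  rw [← hammingDist_ne_zero] at hxy'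
  by_cases hb₁ : b₁ <;> by_cases hb₂ : b₂ <;>
    simp only [Compatible, linked_of_same trivial, hb₁, hb₂, true_implies, false_implies,
      and_true, true_and, not_true_eq_false, not_false_eq_true, iff_true, iff_false] at * <;> omega

/-- If all pairs are compatible, the further copy works. Otherwise two of the points, both to be
joined, are at distance 2k, and their own copy has points at distance 2k-1 from both. -/
theorem exists_copy_linked_of_eq (hk : 1 ≤ k) (hf : f ≠ c₁)
    (hxy : b₁ → b₂ → ¬ Linked k True (hammingDist x y))
    (hxz : b₁ → b₃ → ¬ Linked k True (hammingDist x z))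
    (hyz : b₂ → b₃ → ¬ Linked k True (hammingDist y z))
    (hxy' : ¬ (b₁ ↔ b₂) → x ≠ y) (hxz' : ¬ (b₁ ↔ b₃) → x ≠ z) (hyz' : ¬ (b₂ ↔ b₃) → y ≠ z) :
    ∃ c v, (c = c₁ ∨ c = f) ∧ (Linked k (c = c₁) (hammingDist v x) ↔ b₁) ∧
      (Linked k (c = c₁) (hammingDist v y) ↔ b₂) ∧
      (Linked k (c = c₁) (hammingDist v z) ↔ b₃) := by
  have eyx := hammingDist_comm y x
  have ezx := hammingDist_comm z x
  have ezy := hammingDist_comm z y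
  by_cases h₁₂ : Compatible k b₁ b₂ (hammingDist x y)
  · by_cases h₁₃ : Compatible k b₁ b₃ (hammingDist x z)
    · by_cases h₂₃ : Compatible k b₂ b₃ (hammingDist y z)
      · obtain ⟨v, hx, hy, hz⟩ := exists_of_compatible x y z hk b₁ b₂ b₃ h₁₂ h₁₃ h₂₃
        exact ⟨f, v, Or.inr rfl, by rwa [linked_of_ne hf], by rwa [linked_of_ne hf],
          by rwa [linked_of_ne hf]⟩
      · obtain ⟨h₂, h₃, h⟩ := dist_eq_of_not_compatible h₂₃ hyz hyz'
        obtain ⟨v, hy, hz, hx⟩ := exists_copy_linked_of_eq_of_dist_eq (z := x) (b₃ := b₁) hk h₂ h₃ h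
          (fun h' => by rw [eyx]; exact hxy h' h₂) (fun h' => by rw [ezx]; exact hxz h' h₃)
          (fun h' => (hxy' fun e => h' (e.2 h₂)).symm) (fun h' => (hxz' fun e => h' (e.2 h₃)).symm)
        exact ⟨c₁, v, Or.inl rfl, by simpa using hx, by simpa using hy, by simpa using hz⟩
    · obtain ⟨h₁, h₃, h⟩ := dist_eq_of_not_compatible h₁₃ hxz hxz'
      obtain ⟨v, hx, hz, hy⟩ := exists_copy_linked_of_eq_of_dist_eq (z := y) (b₃ := b₂) hk h₁ h₃ h
        (fun h' => hxy h₁ h') (fun h' => by rw [ezy]; exact hyz h' h₃)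
        (fun h' => hxy' fun e => h' (e.1 h₁)) (fun h' => (hyz' fun e => h' (e.2 h₃)).symm)
      exact ⟨c₁, v, Or.inl rfl, by simpa using hx, by simpa using hy, by simpa using hz⟩
  · obtain ⟨h₁, h₂, h⟩ := dist_eq_of_not_compatible h₁₂ hxy hxy'
    obtain ⟨v, hx, hy, hz⟩ := exists_copy_linked_of_eq_of_dist_eq (z := z) (b₃ := b₃) hk h₁ h₂ h
      (fun h' => hxz h₁ h') (fun h' => hyz h₂ h')
      (fun h' => hxz' fun e => h' (e.1 h₁)) (fun h' => hyz' fun e => h' (e.1 h₂))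
    exact ⟨c₁, v, Or.inl rfl, by simpa using hx, by simpa using hy, by simpa using hz⟩

/-- Prescribed adjacencies to three vertices are realized in one of their copies of the cube or
in a further copy `f`. -/
theorem exists_copy_linked (hk : 1 ≤ k) (hf₁ : f ≠ c₁) (hf₂ : f ≠ c₂) (hf₃ : f ≠ c₃)
    (hxy : b₁ → b₂ → ¬ Linked k (c₁ = c₂) (hammingDist x y))
    (hxz : b₁ → b₃ → ¬ Linked k (c₁ = c₃) (hammingDist x z))
    (hyz : b₂ → b₃ → ¬ Linked k (c₂ = c₃) (hammingDist y z))
    (hxy' : ¬ (b₁ ↔ b₂) → c₁ = c₂ → x ≠ y) (hxz' : ¬ (b₁ ↔ b₃) → c₁ = c₃ → x ≠ z)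
    (hyz' : ¬ (b₂ ↔ b₃) → c₂ = c₃ → y ≠ z) :
    ∃ c v, (c = c₁ ∨ c = c₂ ∨ c = c₃ ∨ c = f) ∧
      (Linked k (c = c₁) (hammingDist v x) ↔ b₁) ∧
      (Linked k (c = c₂) (hammingDist v y) ↔ b₂) ∧
      (Linked k (c = c₃) (hammingDist v z) ↔ b₃) := by
  have le : ∀ {s : Prop} {d : ℕ}, ¬ s → ¬ Linked k s d → d ≤ 2 * k - 1 := by
    intro s d hs h
    rw [linked_of_ne hs] at h
    omega
  by_cases h₁₂ : c₁ = c₂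
  · subst h₁₂
    by_cases h₁₃ : c₁ = c₃
    · subst h₁₃
      obtain ⟨c, v, hc, h⟩ := exists_copy_linked_of_eq hk hf₁ (by simpa using hxy)
        (by simpa using hxz) (by simpa using hyz) (by simpa using hxy') (by simpa using hxz')
        (by simpa using hyz')
      exact ⟨c, v, by clear * - hc; tauto, h⟩
    · obtain ⟨c, v, hc, h⟩ := exists_copy_linked_of_eq_of_ne hk h₁₃ hf₁ hf₃ (by simpa using hxy)
        (fun h h' => le h₁₃ (hxz h h')) (fun h h' => le h₁₃ (hyz h h')) (by simpa using hxy')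
      exact ⟨c, v, by clear * - hc; tauto, h⟩
  by_cases h₁₃ : c₁ = c₃
  · subst h₁₃
    obtain ⟨c, v, hc, hx, hz, hy⟩ := exists_copy_linked_of_eq_of_ne hk h₁₂ hf₁ hf₂
      (by simpa using hxz) (fun h h' => le h₁₂ (hxy h h'))
      (fun h h' => by rw [hammingDist_comm]; exact le (Ne.symm h₁₂) (hyz h' h)) (by simpa using hxz')
    exact ⟨c, v, by clear * - hc; tauto, hx, hy, hz⟩
  by_cases h₂₃ : c₂ = c₃
  · subst h₂₃
    obtain ⟨c, v, hc, hy, hz, hx⟩ := exists_copy_linked_of_eq_of_ne hk (Ne.symm h₁₂) hf₂ hf₁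
      (by simpa using hyz) (fun h h' => by rw [hammingDist_comm]; exact le h₁₂ (hxy h' h))
      (fun h h' => by rw [hammingDist_comm]; exact le h₁₂ (hxz h' h)) (by simpa using hyz')
    exact ⟨c, v, by clear * - hc; tauto, hx, hy, hz⟩
  exact exists_copy_linked_of_pairwise_ne hk h₁₂ h₁₃ h₂₃ hf₁ hf₂ hf₃
    (fun h h' => le h₁₂ (hxy h h')) (fun h h' => le h₁₃ (hxz h h')) (fun h h' => le h₂₃ (hyz h h'))

end Copies

/-! ### The twist and its effect on distances -/

section Twist

variable {n : ℕ} (hn : 2 ≤ n)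

/-- `twist` as a permutation of the cube. -/
def twistPerm : Equiv.Perm (Fin n → ZMod 2) where
  toFun := twist hn
  invFun x := fun i =>
    if i.val = 0 then x ⟨1, by omega⟩ + 1
    else if i.val = 1 then x ⟨0, by omega⟩
    else x i
  left_inv x := by
    have h : ∀ a : ZMod 2, a + 1 + 1 = a := by decide
    have p0 : 0 < n := by omega
    have p1 : 1 < n := by omega
    ext i
    by_cases h0 : i.val = 0
    · obtain rfl : i = ⟨0, p0⟩ := Fin.ext h0
      simp [twist, h]
    · by_cases h1 : i.val = 1
      · obtain rfl : i = ⟨1, p1⟩ := Fin.ext h1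
        simp [twist]
      · simp [twist, h0, h1]
  right_inv x := by
    have h : ∀ a : ZMod 2, a + 1 + 1 = a := by decide
    have p0 : 0 < n := by omega
    have p1 : 1 < n := by omega
    ext i
    by_cases h0 : i.val = 0
    · obtain rfl : i = ⟨0, p0⟩ := Fin.ext h0
      simp [twist]
    · by_cases h1 : i.val = 1
      · obtain rfl : i = ⟨1, p1⟩ := Fin.ext h1
        simp [twist, h]
      · simp [twist, h0, h1]

/-- The first two coordinates. -/
def head (x : Fin n → ZMod 2) : ZMod 2 × ZMod 2 := (x ⟨0, by omega⟩, x ⟨1, by omega⟩)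

/-- The Hamming distance of pairs. -/
def headDist (p q : ZMod 2 × ZMod 2) : ℕ :=
  (if p.1 ≠ q.1 then 1 else 0) + (if p.2 ≠ q.2 then 1 else 0)

/-- The Hamming distance outside the first two coordinates. -/
def tailDist (x y : Fin n → ZMod 2) : ℕ :=
  ∑ i, if 2 ≤ i.val ∧ x i ≠ y i then 1 else 0

theorem hammingDist_eq_headDist_add (x y : Fin n → ZMod 2) :
    hammingDist x y = headDist (head hn x) (head hn y) + tailDist x y := by
  obtain ⟨N, rfl⟩ : ∃ N, n = N + 2 := ⟨n - 2, by omega⟩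
  rw [hammingDist, Finset.card_filter, tailDist, headDist, Fin.sum_univ_succ, Fin.sum_univ_succ,
    Fin.sum_univ_succ (n := N + 1), Fin.sum_univ_succ (n := N)]
  by_cases h₀ : x 0 = y 0 <;> by_cases h₁ : x 1 = y 1 <;> simp [h₀, h₁, head, add_assoc]
  omega

/-- The action of the twist (`b = true`) or of its inverse on the first two coordinates. -/
def headShift (b : Bool) (p : ZMod 2 × ZMod 2) : ZMod 2 × ZMod 2 :=
  bif b then (p.2, p.1 + 1) else (p.2 + 1, p.1)

/-- The twist (`b = true`) or its inverse. -/
def twistPow (b : Bool) : Equiv.Perm (Fin n → ZMod 2) :=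
  bif b then twistPerm hn else (twistPerm hn)⁻¹

theorem twistPow_not (b : Bool) : twistPow hn (!b) = (twistPow hn b)⁻¹ := by
  cases b <;> simp [twistPow]

theorem head_twistPow (b : Bool) (x : Fin n → ZMod 2) :
    head hn (twistPow hn b x) = headShift b (head hn x) := by
  cases b
  · rfl
  · rfl

theorem twistPow_apply_of_two_le (b : Bool) (x : Fin n → ZMod 2) {i : Fin n} (hi : 2 ≤ i.val) :
    twistPow hn b x i = x i := by
  have h0 : i.val ≠ 0 := by omega
  have h1 : i.val ≠ 1 := by omega
  cases b
  · change (if i.val = 0 then _ else if i.val = 1 then _ else x i) = x i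
    rw [if_neg h0, if_neg h1]
  · change (if i.val = 0 then _ else if i.val = 1 then _ else x i) = x i
    rw [if_neg h0, if_neg h1]

theorem tailDist_comm (x y : Fin n → ZMod 2) : tailDist x y = tailDist y x := by
  simp only [tailDist, ne_comm]

theorem tailDist_twistPow_left (b : Bool) (x y : Fin n → ZMod 2) :
    tailDist (twistPow hn b x) y = tailDist x y := by
  refine Finset.sum_congr rfl fun i _ => ?_
  by_cases hi : 2 ≤ i.val
  · rw [twistPow_apply_of_two_le hn b x hi]
  · simp [hi]

theorem tailDist_twistPow_right (b : Bool) (x y : Fin n → ZMod 2) :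
    tailDist x (twistPow hn b y) = tailDist x y := by
  rw [tailDist_comm, tailDist_twistPow_left, tailDist_comm]

theorem headDist_headShift : ∀ b p q, headDist (headShift b p) (headShift b q) = headDist p q := by
  decide

theorem hammingDist_twistPow (b : Bool) (x y : Fin n → ZMod 2) :
    hammingDist (twistPow hn b x) (twistPow hn b y) = hammingDist x y := by
  simp only [hammingDist_eq_headDist_add hn, head_twistPow, tailDist_twistPow_left,
    tailDist_twistPow_right, headDist_headShift]

/-- Pairs of bits form a 4-cycle, with `headDist` as cyclic distance and `headShift` as a quarter
turn one way or the other. Turning both points changes their cyclic difference by an even amount,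
turning one by an odd amount. So the two distances, both in {0, 1, 2}, have opposite parity and
differ by one. -/
theorem headDist_flip : ∀ b b₁ b₂ p q,
    headDist (headShift b₁ p) (headShift b₂ q) = headDist p (headShift b q) + 1 ∨
      headDist (headShift b₁ p) (headShift b₂ q) + 1 = headDist p (headShift b q) := by
  decide

theorem hammingDist_flip (b b₁ b₂ : Bool) (x y : Fin n → ZMod 2) :
    hammingDist (twistPow hn b₁ x) (twistPow hn b₂ y) = hammingDist x (twistPow hn b y) + 1 ∨
      hammingDist (twistPow hn b₁ x) (twistPow hn b₂ y) + 1 = hammingDist x (twistPow hn b y) := by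
  simp only [hammingDist_eq_headDist_add hn, head_twistPow, tailDist_twistPow_left,
    tailDist_twistPow_right]
  have := headDist_flip b b₁ b₂ (head hn x) (head hn y)
  omega

/-- For three points, the distance `u i` of the two points other than the `i`-th one as seen from
either of them, and the same distance `v i` as seen from the `i`-th vertex and `w i` as seen from a
fourth vertex. -/
def FlipLaw (u v w : Fin 3 → ℕ) : Prop :=
  (v 0 = w 0 → (v 0 = u 0 + 1 ↔ (v 1 = u 1 + 1 ↔ ¬ v 2 = u 2 + 1))) ∧
  (v 1 = w 1 → (v 1 = u 1 + 1 ↔ (v 2 = u 2 + 1 ↔ ¬ v 0 = u 0 + 1))) ∧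
  (v 2 = w 2 → (v 2 = u 2 + 1 ↔ (v 0 = u 0 + 1 ↔ ¬ v 1 = u 1 + 1)))

instance (u v w : Fin 3 → ℕ) : Decidable (FlipLaw u v w) :=
  inferInstanceAs (Decidable (_ ∧ _ ∧ _))

set_option maxRecDepth 100000 in
-- The two quarter turns of a point are antipodal, so each hypothesis makes the corresponding
-- entries of the last two vectors add up to 2. They agree only if both are 1, and otherwise lie on
-- opposite sides of the entry in the first vector. The law says that one agreement forces the
-- number of increases from the first vector to the second to be even, which is a finite check.
theorem headDist_flipLaw : ∀ b₁₂ b₁₃ b₂₃ b₄₁ b₄₂ b₄₃ : Bool,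
    (b₁₃ == b₂₃) ≠ (b₄₁ == b₄₂) → (b₁₂ == !b₂₃) ≠ (b₄₁ == b₄₃) → (b₁₂ == b₁₃) ≠ (b₄₂ == b₄₃) →
    ∀ p q r, FlipLaw
      ![headDist q (headShift b₂₃ r), headDist p (headShift b₁₃ r), headDist p (headShift b₁₂ q)]
      ![headDist (headShift b₁₂ q) (headShift b₁₃ r),
        headDist (headShift (!b₁₂) p) (headShift b₂₃ r),
        headDist (headShift (!b₁₃) p) (headShift (!b₂₃) q)]
      ![headDist (headShift b₄₂ q) (headShift b₄₃ r),
        headDist (headShift b₄₁ p) (headShift b₄₃ r),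
        headDist (headShift b₄₁ p) (headShift b₄₂ q)] := by
  decide

theorem hammingDist_flipLaw (b₁₂ b₁₃ b₂₃ b₄₁ b₄₂ b₄₃ : Bool)
    (h₁ : (b₁₃ == b₂₃) ≠ (b₄₁ == b₄₂)) (h₂ : (b₁₂ == !b₂₃) ≠ (b₄₁ == b₄₃))
    (h₃ : (b₁₂ == b₁₃) ≠ (b₄₂ == b₄₃)) (x y z : Fin n → ZMod 2) :
    FlipLaw
      ![hammingDist y (twistPow hn b₂₃ z), hammingDist x (twistPow hn b₁₃ z),
        hammingDist x (twistPow hn b₁₂ y)]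
      ![hammingDist (twistPow hn b₁₂ y) (twistPow hn b₁₃ z),
        hammingDist (twistPow hn (!b₁₂) x) (twistPow hn b₂₃ z),
        hammingDist (twistPow hn (!b₁₃) x) (twistPow hn (!b₂₃) y)]
      ![hammingDist (twistPow hn b₄₂ y) (twistPow hn b₄₃ z),
        hammingDist (twistPow hn b₄₁ x) (twistPow hn b₄₃ z),
        hammingDist (twistPow hn b₄₁ x) (twistPow hn b₄₂ y)] := by
  have := headDist_flipLaw b₁₂ b₁₃ b₂₃ b₄₁ b₄₂ b₄₃ h₁ h₂ h₃ (head hn x) (head hn y) (head hn z)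
  simp only [hammingDist_eq_headDist_add hn, head_twistPow, tailDist_twistPow_left,
    tailDist_twistPow_right]
  simp only [FlipLaw, Matrix.cons_val] at this ⊢
  refine ⟨fun h => ?_, fun h => ?_, fun h => ?_⟩
  · have := this.1 (by omega)
    omega
  · have := this.2.1 (by omega)
    omega
  · have := this.2.2 (by omega)
    omega

end Twist

theorem two_le_three_mul_sub_one {k : ℕ} (hk : 1 ≤ k) : 2 ≤ 3 * k - 1 := by
  omega

/-! ### Coordinate changes between tournament vertices, and triangle-freeness -/

section TwistedGraph

variable {V : Type*} (T : Tournament V) {n : ℕ} (hn : 2 ≤ n)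

open Classical in
/-- The coordinate change from the cubes over `i` to those over `c`. -/
noncomputable def frameShift (c i : V) : Equiv.Perm (Fin n → ZMod 2) :=
  if c = i then 1 else twistPow hn (decide (T.Adj c i))

theorem frameShift_self (c : V) : frameShift T hn c c = 1 := if_pos rfl

open Classical in
theorem frameShift_of_ne {c i : V} (h : c ≠ i) :
    frameShift T hn c i = twistPow hn (decide (T.Adj c i)) := if_neg h

open Classical in
theorem Tournament.decide_adj_swap {c i : V} (h : c ≠ i) :
    decide (T.Adj i c) = !decide (T.Adj c i) := by
  have := T.exactlyOne i c h.symm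
  by_cases h' : T.Adj c i <;> simp_all

theorem frameShift_swap (c i : V) : frameShift T hn i c = (frameShift T hn c i)⁻¹ := by
  by_cases h : c = i
  · subst h
    simp [frameShift_self]
  · rw [frameShift_of_ne T hn h, frameShift_of_ne T hn (Ne.symm h), T.decide_adj_swap h,
      twistPow_not]

theorem hammingDist_frameShift (c i : V) (x y : Fin n → ZMod 2) :
    hammingDist (frameShift T hn c i x) (frameShift T hn c i y) = hammingDist x y := by
  by_cases h : c = i
  · subst h
    simp [frameShift_self]
  · rw [frameShift_of_ne T hn h, hammingDist_twistPow]

theorem hammingDist_frameShift_right (c i : V) (x y : Fin n → ZMod 2) :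
    hammingDist x (frameShift T hn c i y) = hammingDist (frameShift T hn i c x) y := by
  rw [← hammingDist_frameShift T hn i c, frameShift_swap T hn c i]
  simp

variable {T} in
theorem hammingDist_frameShift_flip {c i j : V} (hij : i ≠ j) (hi : c ≠ i) (hj : c ≠ j)
    (x y : Fin n → ZMod 2) :
    hammingDist (frameShift T hn c i x) (frameShift T hn c j y) =
        hammingDist x (frameShift T hn i j y) + 1 ∨
      hammingDist (frameShift T hn c i x) (frameShift T hn c j y) + 1 =
        hammingDist x (frameShift T hn i j y) := by
  rw [frameShift_of_ne T hn hij, frameShift_of_ne T hn hi, frameShift_of_ne T hn hj]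
  exact hammingDist_flip hn _ _ _ x y

variable {m k : ℕ} (hk : 1 ≤ k)

theorem twistedGraph_adj_iff (p q : V × Fin m × (Fin (3 * k - 1) → ZMod 2)) :
    (twistedGraph T m k hk).Adj p q ↔
      Linked k ((p.1, p.2.1) = (q.1, q.2.1))
        (hammingDist p.2.2 (frameShift T (two_le_three_mul_sub_one hk) p.1 q.1 q.2.2)) := by
  -- The upper end 3k-1 of every range of distances is automatic.
  have hle : ∀ x y : Fin (3 * k - 1) → ZMod 2, hammingDist x y ≤ 3 * k - 1 := fun x y =>
    hammingDist_le_card_fintype.trans_eq (Fintype.card_fin _)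
  change (p.1 = q.1 ∧ (hypercubeGraph m k hk).Adj p.2 q.2) ∨
    (T.Adj p.1 q.1 ∧
      hammingDist p.2.2 (twist (by omega) q.2.2) ∈ Finset.Icc (2 * k) (3 * k - 1)) ∨
    (T.Adj q.1 p.1 ∧
      hammingDist q.2.2 (twist (by omega) p.2.2) ∈ Finset.Icc (2 * k) (3 * k - 1)) ↔ _
  obtain ⟨i, j, x⟩ := p
  obtain ⟨i', j', y⟩ := q
  by_cases h : i = i'
  · subst h
    simp only [T.irrefl, false_and, or_false, true_and, frameShift_self, Equiv.Perm.coe_one, id,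
      Prod.mk.injEq, Linked]
    change (j = j' ∧ hammingDist x y ∈ insert (2 * k - 1) (Finset.Icc (2 * k + 1) (3 * k - 1))) ∨
      (j ≠ j' ∧ hammingDist x y ∈ Finset.Icc (2 * k) (3 * k - 1)) ↔ _
    simp only [Finset.mem_insert, Finset.mem_Icc, hle, and_true, ne_eq]
  · have h' : ¬ (i, j) = (i', j') := fun e => h (Prod.ext_iff.1 e).1
    simp only [h, false_and, false_or, linked_of_ne h', Finset.mem_Icc, hle, and_true]
    have hs := T.exactlyOne i i' h
    by_cases ha : T.Adj i i'
    · have hb : ¬ T.Adj i' i := hs.1 ha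
      simp only [ha, hb, true_and, false_and, or_false, frameShift_of_ne T _ h, decide_true]
      rfl
    · have hb : T.Adj i' i := by tauto
      rw [hammingDist_frameShift_right, hammingDist_comm _ y]
      simp only [ha, hb, true_and, false_and, false_or, frameShift_of_ne T _ (Ne.symm h),
        decide_true, hammingDist_comm y]
      rfl

variable {T} in
/-- Over two vertices of the tournament, the coordinate changes are compatible. -/
theorem frameShift_comp {i₀ i₁ a b : V} (ha : a = i₀ ∨ a = i₁) (hb : b = i₀ ∨ b = i₁)
    (x : Fin n → ZMod 2) :
    frameShift T hn a b x = frameShift T hn a i₀ (frameShift T hn i₀ b x) := by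
  rcases ha with ha | ha
  · simp [ha, frameShift_self]
  · rcases hb with hb | hb
    · simp [hb, frameShift_self]
    · rw [ha, hb, frameShift_swap T hn i₀ i₁]
      simp [frameShift_self]

variable {T} in
theorem hammingDist_frameShift_comp {i₀ i₁ a b : V} (ha : a = i₀ ∨ a = i₁) (hb : b = i₀ ∨ b = i₁)
    (x y : Fin n → ZMod 2) :
    hammingDist x (frameShift T hn a b y) =
      hammingDist (frameShift T hn i₀ a x) (frameShift T hn i₀ b y) := by
  rw [frameShift_comp hn ha hb, hammingDist_frameShift_right]

/-- The distances have an even sum of at most 6k-2. In a single copy the sum would be 6k-3 or at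
least 6k-1; with two or three copies it would be at least 6k-1. -/
theorem not_linked_triangle {C : Type*} {c₁ c₂ c₃ : C} (hk : 1 ≤ k)
    (x y z : Fin (3 * k - 1) → ZMod 2)
    (hxy : Linked k (c₁ = c₂) (hammingDist x y)) (hxz : Linked k (c₁ = c₃) (hammingDist x z))
    (hyz : Linked k (c₂ = c₃) (hammingDist y z)) : False := by
  obtain ⟨a, b, c, p, hn, h₁, h₂, h₃, -⟩ := exists_hammingDist_triple x y z
  by_cases h₁₂ : c₁ = c₂
  · subst h₁₂
    by_cases h₁₃ : c₁ = c₃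
    · subst h₁₃
      rw [linked_of_same rfl] at hxy hxz hyz
      omega
    · rw [linked_of_ne h₁₃] at hxz hyz
      rw [linked_of_same rfl] at hxy
      omega
  · by_cases h₁₃ : c₁ = c₃
    · subst h₁₃
      rw [linked_of_ne h₁₂] at hxy
      rw [linked_of_ne (Ne.symm h₁₂)] at hyz
      rw [linked_of_same rfl] at hxz
      omega
    · rw [linked_of_ne h₁₂] at hxy
      rw [linked_of_ne h₁₃] at hxz
      unfold Linked at hyz
      omega

theorem exists_pair_or_pairwise_ne (a b c : V) :
    (∃ i₀ i₁ : V, (a = i₀ ∨ a = i₁) ∧ (b = i₀ ∨ b = i₁) ∧ (c = i₀ ∨ c = i₁)) ∨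
      (a ≠ b ∧ a ≠ c ∧ b ≠ c) := by
  by_cases h : a = b
  · exact Or.inl ⟨a, c, by simp [h]⟩
  by_cases h' : a = c
  · exact Or.inl ⟨a, b, by simp [h']⟩
  by_cases h'' : b = c
  · exact Or.inl ⟨a, b, by simp [h'']⟩
  exact Or.inr ⟨h, h', h''⟩

theorem twistedGraph_cliqueFree : (twistedGraph T m k hk).CliqueFree 3 := by
  classical
  intro s hs
  obtain ⟨p, q, r, hpq, hpr, hqr, -⟩ := SimpleGraph.is3Clique_iff.1 hs
  rw [twistedGraph_adj_iff] at hpq hpr hqr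
  have hn := two_le_three_mul_sub_one hk
  rcases exists_pair_or_pairwise_ne p.1 q.1 r.1 with ⟨i₀, i₁, hp, hq, hr⟩ | ⟨h₁₂, h₁₃, h₂₃⟩
  · rw [hammingDist_frameShift_comp hn hp hq] at hpq
    rw [hammingDist_frameShift_comp hn hp hr] at hpr
    rw [hammingDist_frameShift_comp hn hq hr] at hqr
    exact not_linked_triangle hk _ _ _ hpq hpr hqr
  · have ne : ∀ {u v : V × Fin m × (Fin (3 * k - 1) → ZMod 2)}, u.1 ≠ v.1 →
        ¬ (u.1, u.2.1) = (v.1, v.2.1) := fun h e => h (Prod.ext_iff.1 e).1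
    rw [linked_of_ne (ne h₁₂)] at hpq
    rw [linked_of_ne (ne h₁₃)] at hpr
    rw [linked_of_ne (ne h₂₃)] at hqr
    -- Passing to the coordinates over the first vertex lowers the third distance by at most one, so
    -- the sum is still at least 6k-1, above 2n.
    have := hammingDist_frameShift_flip (T := T) hn h₂₃ h₁₂ h₁₃ q.2.2 r.2.2
    obtain ⟨a, b, c, d, hsum, h₁, h₂, h₃, -⟩ := exists_hammingDist_triple p.2.2
      (frameShift T hn p.1 q.1 q.2.2) (frameShift T hn p.1 r.1 r.2.2)
    omega

end TwistedGraph

/-! ### Shattered tournaments -/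

/-- As seen from the third vertex and as seen from the fourth one, exactly one of the two
orientations agrees on the two vertices `a` and `b`. -/
def Tournament.Separated {V : Type*} (T : Tournament V) (a b c d : V) : Prop :=
  (T.Adj c a ↔ T.Adj c b) ↔ ¬ (T.Adj d a ↔ T.Adj d b)

instance : DecidableRel Tournament.T4.Adj := fun i j =>
  inferInstanceAs (Decidable ((i, j) ∈ (_ : Finset (Fin 4 × Fin 4))))

instance : DecidableRel Tournament.T4'.Adj := fun i j =>
  inferInstanceAs (Decidable (Tournament.T4.Adj j i))

theorem Tournament.T4_separated : ∀ a b c : Fin 4, a ≠ b → a ≠ c → b ≠ c →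
    ∃ d, a ≠ d ∧ b ≠ d ∧ c ≠ d ∧
      T4.Separated b c a d ∧ T4.Separated a c b d ∧ T4.Separated a b c d := by
  unfold Tournament.Separated
  decide

theorem Tournament.T4'_separated : ∀ a b c : Fin 4, a ≠ b → a ≠ c → b ≠ c →
    ∃ d, a ≠ d ∧ b ≠ d ∧ c ≠ d ∧
      T4'.Separated b c a d ∧ T4'.Separated a c b d ∧ T4'.Separated a b c d := by
  unfold Tournament.Separated
  decide

/-- This is the only use of shattering: the three separations are the hypotheses of the flip law. -/
theorem Tournament.IsShattered.exists_separated {V : Type*} {T : Tournament V}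
    (hT : T.IsShattered) {a b c : V} (hab : a ≠ b) (hac : a ≠ c) (hbc : b ≠ c) :
    ∃ d, a ≠ d ∧ b ≠ d ∧ c ≠ d ∧
      T.Separated b c a d ∧ T.Separated a c b d ∧ T.Separated a b c d := by
  obtain ⟨f, hf, ⟨a, rfl⟩, ⟨b, rfl⟩, ⟨c, rfl⟩⟩ := hT a b c hab hac hbc
  rw [f.injective.ne_iff] at hab hac hbc
  rcases hf with hf | hf
  · obtain ⟨d, had, hbd, hcd, h⟩ := T4_separated a b c hab hac hbc
    refine ⟨f d, f.injective.ne had, f.injective.ne hbd, f.injective.ne hcd, ?_⟩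
    simpa only [Separated, hf _ _] using h
  · obtain ⟨d, had, hbd, hcd, h⟩ := T4'_separated a b c hab hac hbc
    refine ⟨f d, f.injective.ne had, f.injective.ne hbd, f.injective.ne hcd, ?_⟩
    simpa only [Separated, hf _ _] using h

/-! ### Distances seen from a fourth tournament vertex -/

/-- All three distances go up, an odd number, so the law excludes every equality between v and w.
Hence each w is u - 1. -/
theorem FlipLaw.dist_le {k u₁ u₂ u₃ v₁ v₂ v₃ w₁ w₂ w₃ : ℕ}
    (h : FlipLaw ![u₁, u₂, u₃] ![v₁, v₂, v₃] ![w₁, w₂, w₃])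
    (hv₁ : v₁ = u₁ + 1 ∨ v₁ + 1 = u₁) (hv₂ : v₂ = u₂ + 1 ∨ v₂ + 1 = u₂)
    (hv₃ : v₃ = u₃ + 1 ∨ v₃ + 1 = u₃)
    (hw₁ : w₁ = u₁ + 1 ∨ w₁ + 1 = u₁) (hw₂ : w₂ = u₂ + 1 ∨ w₂ + 1 = u₂)
    (hw₃ : w₃ = u₃ + 1 ∨ w₃ + 1 = u₃)
    (h₁ : u₁ ≤ 2 * k - 1) (h₂ : u₂ ≤ 2 * k - 1) (h₃ : u₃ ≤ 2 * k - 1)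
    (hc₁ : ¬ v₁ ≤ 2 * k - 2) (hc₂ : ¬ v₂ ≤ 2 * k - 2) (hc₃ : ¬ v₃ ≤ 2 * k - 2) :
    w₁ ≤ 2 * k - 2 ∧ w₂ ≤ 2 * k - 2 ∧ w₃ ≤ 2 * k - 2 := by
  have e₁ : v₁ = u₁ + 1 := by omega
  have e₂ : v₂ = u₂ + 1 := by omega
  have e₃ : v₃ = u₃ + 1 := by omega
  obtain ⟨l₁, l₂, l₃⟩ := h
  simp only [Matrix.cons_val, e₁, e₂, e₃, not_true_eq_false, iff_false, imp_false] at l₁ l₂ l₃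
  omega

/-- The relations between the three pairwise distances of three points of a cube. -/
def TriangleDist (d₁ d₂ d₃ : ℕ) : Prop :=
  (d₁ + d₂ + d₃) % 2 = 0 ∧ d₁ ≤ d₂ + d₃ ∧ d₂ ≤ d₁ + d₃ ∧ d₃ ≤ d₁ + d₂

theorem TriangleDist.rotate {d₁ d₂ d₃ : ℕ} (h : TriangleDist d₁ d₂ d₃) :
    TriangleDist d₂ d₃ d₁ := by
  unfold TriangleDist at *
  omega

theorem triangleDist_hammingDist {n : ℕ} (x y z : Fin n → ZMod 2) :
    TriangleDist (hammingDist y z) (hammingDist x z) (hammingDist x y) := by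
  obtain ⟨a, b, c, p, hn, h₁, h₂, h₃, -⟩ := exists_hammingDist_triple x y z
  unfold TriangleDist
  omega

theorem FlipLaw.rotate {u₁ u₂ u₃ v₁ v₂ v₃ w₁ w₂ w₃ : ℕ}
    (h : FlipLaw ![u₁, u₂, u₃] ![v₁, v₂, v₃] ![w₁, w₂, w₃]) :
    FlipLaw ![u₂, u₃, u₁] ![v₂, v₃, v₁] ![w₂, w₃, w₁] :=
  ⟨h.2.1, h.2.2, h.1⟩

/-- The zeros and the triangle inequalities force every u to be 1 and v₃ to be 2. Exactly one
distance goes up, so the law again excludes all equalities, and w is 2, 2, 0. -/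
theorem FlipLaw.dist_le_and_pos {k u₁ u₂ u₃ v₁ v₂ v₃ w₁ w₂ w₃ : ℕ} (hk : 1 ≤ k)
    (h : FlipLaw ![u₁, u₂, u₃] ![v₁, v₂, v₃] ![w₁, w₂, w₃])
    (hv₁ : v₁ = u₁ + 1 ∨ v₁ + 1 = u₁) (hv₂ : v₂ = u₂ + 1 ∨ v₂ + 1 = u₂)
    (hv₃ : v₃ = u₃ + 1 ∨ v₃ + 1 = u₃)
    (hw₁ : w₁ = u₁ + 1 ∨ w₁ + 1 = u₁) (hw₂ : w₂ = u₂ + 1 ∨ w₂ + 1 = u₂)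
    (hw₃ : w₃ = u₃ + 1 ∨ w₃ + 1 = u₃)
    (H₁ : TriangleDist v₁ u₂ u₃) (H₃ : TriangleDist u₁ u₂ v₃)
    (h₃ : u₃ ≤ 2 * k - 1) (hc₁ : v₁ = 0) (hc₂ : v₂ = 0) (hc₃ : ¬ v₃ ≤ 2 * k - 2) :
    1 ≤ w₁ ∧ 1 ≤ w₂ ∧ w₃ ≤ 2 * k - 2 := by
  obtain ⟨_, _, _, _⟩ := H₁
  obtain ⟨_, _, _, _⟩ := H₃
  have e₁ : u₁ = 1 := by omega
  have e₂ : u₂ = 1 := by omega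
  have e₃ : u₃ = 1 := by omega
  have e₄ : v₃ = 2 := by omega
  obtain ⟨l₁, l₂, l₃⟩ := h
  simp only [Matrix.cons_val, e₁, e₂, e₃, e₄, hc₁, hc₂] at l₁ l₂ l₃
  norm_num at l₁ l₂ l₃
  omega

theorem FlipLaw.compatible {k u₁ u₂ u₃ v₁ v₂ v₃ w₁ w₂ w₃ : ℕ} {b₁ b₂ b₃ : Prop} (hk : 1 ≤ k)
    (h : FlipLaw ![u₁, u₂, u₃] ![v₁, v₂, v₃] ![w₁, w₂, w₃])
    (hv₁ : v₁ = u₁ + 1 ∨ v₁ + 1 = u₁) (hv₂ : v₂ = u₂ + 1 ∨ v₂ + 1 = u₂)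
    (hv₃ : v₃ = u₃ + 1 ∨ v₃ + 1 = u₃)
    (hw₁ : w₁ = u₁ + 1 ∨ w₁ + 1 = u₁) (hw₂ : w₂ = u₂ + 1 ∨ w₂ + 1 = u₂)
    (hw₃ : w₃ = u₃ + 1 ∨ w₃ + 1 = u₃)
    (H₁ : TriangleDist v₁ u₂ u₃) (H₂ : TriangleDist u₁ v₂ u₃) (H₃ : TriangleDist u₁ u₂ v₃)
    (h₁ : b₂ → b₃ → u₁ ≤ 2 * k - 1) (h₂ : b₁ → b₃ → u₂ ≤ 2 * k - 1)
    (h₃ : b₁ → b₂ → u₃ ≤ 2 * k - 1) (hc₁ : ¬ Compatible k b₂ b₃ v₁)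
    (hc₂ : ¬ Compatible k b₁ b₃ v₂) (hc₃ : ¬ Compatible k b₁ b₂ v₃) :
    Compatible k b₂ b₃ w₁ ∧ Compatible k b₁ b₃ w₂ ∧ Compatible k b₁ b₂ w₃ := by
  unfold Compatible at *
  by_cases hb₁ : b₁ <;> by_cases hb₂ : b₂ <;> by_cases hb₃ : b₃ <;>
    simp only [hb₁, hb₂, hb₃, true_implies, false_implies, and_true, true_and,
      not_true_eq_false, not_false_eq_true] at *
  · exact h.dist_le hv₁ hv₂ hv₃ hw₁ hw₂ hw₃ h₁ h₂ h₃ hc₁ hc₂ hc₃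
  · exact h.dist_le_and_pos hk hv₁ hv₂ hv₃ hw₁ hw₂ hw₃ H₁ H₃ h₃ (by omega) (by omega) hc₃
  · have := h.rotate.rotate.dist_le_and_pos hk hv₃ hv₁ hv₂ hw₃ hw₁ hw₂ H₃.rotate.rotate
      H₂.rotate.rotate h₂ (by omega) (by omega) hc₂
    exact ⟨this.2.1, this.2.2, this.1⟩
  · have := h.rotate.dist_le_and_pos hk hv₂ hv₃ hv₁ hw₂ hw₃ hw₁ H₂.rotate
      H₁.rotate h₁ (by omega) (by omega) hc₁
    exact ⟨this.2.2, this.1, this.2.1⟩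

/-! ### Existential completeness -/

section

variable {V : Type*} {T : Tournament V} {m k : ℕ} {b₁ b₂ b₃ : Prop}

/-- The new vertex lies over `p.1`, in the copy of p or in a second one provided by m ≥ 2; q and r
are moved into the coordinates there. -/
theorem exists_adj_of_compatible (hk : 1 ≤ k) (hm : 2 ≤ m)
    (p q r : V × Fin m × (Fin (3 * k - 1) → ZMod 2)) (hpq : p.1 ≠ q.1) (hpr : p.1 ≠ r.1)
    (h₁₂ : b₁ → b₂ → ¬ (twistedGraph T m k hk).Adj p q)
    (h₁₃ : b₁ → b₃ → ¬ (twistedGraph T m k hk).Adj p r)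
    (h₂₃ : Compatible k b₂ b₃ (hammingDist
      (frameShift T (two_le_three_mul_sub_one hk) p.1 q.1 q.2.2)
      (frameShift T (two_le_three_mul_sub_one hk) p.1 r.1 r.2.2))) :
    ∃ v, ((twistedGraph T m k hk).Adj v p ↔ b₁) ∧ ((twistedGraph T m k hk).Adj v q ↔ b₂) ∧
      ((twistedGraph T m k hk).Adj v r ↔ b₃) := by
  have : Nontrivial (Fin m) := Fin.nontrivial_iff_two_le.2 hm
  obtain ⟨j, hj⟩ := exists_ne p.2.1
  have ne : ∀ {u : V} {j : Fin m} {v : V × Fin m × (Fin (3 * k - 1) → ZMod 2)}, u ≠ v.1 →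
      (u, j) ≠ (v.1, v.2.1) := fun h e => h (Prod.ext_iff.1 e).1
  simp only [twistedGraph_adj_iff] at h₁₂ h₁₃ ⊢
  rw [linked_of_ne (ne hpq)] at h₁₂
  rw [linked_of_ne (ne hpr)] at h₁₃
  obtain ⟨c, v, hc, hx, hy, hz⟩ := exists_copy_linked_of_compatible (f := (p.1, j)) hk
    (ne (j := p.2.1) hpq) (ne (j := p.2.1) hpr) (fun e => hj (Prod.ext_iff.1 e).2) (ne hpq)
    (ne hpr) (x := p.2.2) (fun h h' => by have := h₁₂ h h'; omega)
    (fun h h' => by have := h₁₃ h h'; omega) h₂₃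
  obtain ⟨i, j'⟩ := c
  obtain rfl : i = p.1 := by
    rcases hc with hc | hc <;> exact (Prod.ext_iff.1 hc).1
  refine ⟨(p.1, j', v), ?_, hy, hz⟩
  simpa [frameShift_self] using hx

end

section

variable {V : Type*} {T : Tournament V} {m k : ℕ} {b₁ b₂ b₃ : Prop}

open Classical in
theorem Tournament.Separated.beq_ne {a b c d : V} (h : T.Separated a b c d) :
    (decide (T.Adj c a) == decide (T.Adj c b)) ≠ (decide (T.Adj d a) == decide (T.Adj d b)) := by
  unfold Tournament.Separated at h
  by_cases h₁ : T.Adj c a <;> by_cases h₂ : T.Adj c b <;> by_cases h₃ : T.Adj d a <;>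
    by_cases h₄ : T.Adj d b <;> simp_all

open Classical in
theorem Tournament.Separated.not_beq_ne {a b c d : V} (h : T.Separated a b c d) :
    ((!decide (T.Adj c a)) == !decide (T.Adj c b)) ≠
      (decide (T.Adj d a) == decide (T.Adj d b)) := by
  have not_beq : ∀ s t : Bool, ((!s) == !t) = (s == t) := by decide
  rw [not_beq]
  exact h.beq_ne

open Classical in
theorem exists_adj_of_pairwise_ne (hT : T.IsShattered) (hk : 1 ≤ k) (hm : 2 ≤ m)
    (p q r : V × Fin m × (Fin (3 * k - 1) → ZMod 2))
    (hpq : p.1 ≠ q.1) (hpr : p.1 ≠ r.1) (hqr : q.1 ≠ r.1)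
    (h₁₂ : b₁ → b₂ → ¬ (twistedGraph T m k hk).Adj p q)
    (h₁₃ : b₁ → b₃ → ¬ (twistedGraph T m k hk).Adj p r)
    (h₂₃ : b₂ → b₃ → ¬ (twistedGraph T m k hk).Adj q r) :
    ∃ v, ((twistedGraph T m k hk).Adj v p ↔ b₁) ∧ ((twistedGraph T m k hk).Adj v q ↔ b₂) ∧
      ((twistedGraph T m k hk).Adj v r ↔ b₃) := by
  have hn := two_le_three_mul_sub_one hk
  have symm : ∀ {b b' : Prop} {s t : V × Fin m × (Fin (3 * k - 1) → ZMod 2)},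
      (b → b' → ¬ (twistedGraph T m k hk).Adj s t) →
      b' → b → ¬ (twistedGraph T m k hk).Adj t s := fun h h' h'' e => h h'' h' e.symm
  by_cases hc₁ : Compatible k b₂ b₃
      (hammingDist (frameShift T hn p.1 q.1 q.2.2) (frameShift T hn p.1 r.1 r.2.2))
  · exact exists_adj_of_compatible hk hm p q r hpq hpr h₁₂ h₁₃ hc₁
  by_cases hc₂ : Compatible k b₁ b₃
      (hammingDist (frameShift T hn q.1 p.1 p.2.2) (frameShift T hn q.1 r.1 r.2.2))
  · obtain ⟨v, hq, hp, hr⟩ :=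
      exists_adj_of_compatible hk hm q p r hpq.symm hqr (symm h₁₂) h₂₃ hc₂
    exact ⟨v, hp, hq, hr⟩
  by_cases hc₃ : Compatible k b₁ b₂
      (hammingDist (frameShift T hn r.1 p.1 p.2.2) (frameShift T hn r.1 q.1 q.2.2))
  · obtain ⟨v, hr, hp, hq⟩ :=
      exists_adj_of_compatible hk hm r p q hpr.symm hqr.symm (symm h₁₃) (symm h₂₃) hc₃
    exact ⟨v, hp, hq, hr⟩
  -- All three given tournament vertices fail, so the new vertex is sought over a fourth one.
  obtain ⟨d, hp, hq, hr, s₁, s₂, s₃⟩ := hT.exists_separated hpq hpr hqr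
  have ne : ∀ {u : V} {j : Fin m} {v : V × Fin m × (Fin (3 * k - 1) → ZMod 2)}, v.1 ≠ u →
      (u, j) ≠ (v.1, v.2.1) := fun h e => h (Prod.ext_iff.1 e).1.symm
  have far : ∀ {b b' : Prop} {s t : V × Fin m × (Fin (3 * k - 1) → ZMod 2)}, s.1 ≠ t.1 →
      (b → b' → ¬ (twistedGraph T m k hk).Adj s t) →
      b → b' → hammingDist s.2.2 (frameShift T hn s.1 t.1 t.2.2) ≤ 2 * k - 1 := by
    intro b b' s t hst h hb hb'
    have := h hb hb'
    rw [twistedGraph_adj_iff, linked_of_ne (ne hst.symm)] at this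
    omega
  have law := hammingDist_flipLaw hn (decide (T.Adj p.1 q.1)) (decide (T.Adj p.1 r.1))
    (decide (T.Adj q.1 r.1)) (decide (T.Adj d p.1)) (decide (T.Adj d q.1)) (decide (T.Adj d r.1))
    (by rw [T.decide_adj_swap hpr.symm, T.decide_adj_swap hqr.symm]; exact s₃.not_beq_ne)
    (by rw [T.decide_adj_swap hpq.symm]; exact s₂.not_beq_ne) s₁.beq_ne p.2.2 q.2.2 r.2.2
  rw [← T.decide_adj_swap hpq, ← T.decide_adj_swap hpr, ← T.decide_adj_swap hqr,
    ← frameShift_of_ne T hn hpq, ← frameShift_of_ne T hn hpr, ← frameShift_of_ne T hn hqr,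
    ← frameShift_of_ne T hn hpq.symm, ← frameShift_of_ne T hn hpr.symm,
    ← frameShift_of_ne T hn hqr.symm, ← frameShift_of_ne T hn hp.symm,
    ← frameShift_of_ne T hn hq.symm, ← frameShift_of_ne T hn hr.symm] at law
  obtain ⟨hw₁, hw₂, hw₃⟩ := law.compatible hk
    (hammingDist_frameShift_flip hn hqr hpq hpr _ _)
    (hammingDist_frameShift_flip hn hpr hpq.symm hqr _ _)
    (hammingDist_frameShift_flip hn hpq hpr.symm hqr.symm _ _)
    (hammingDist_frameShift_flip hn hqr hq.symm hr.symm _ _)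
    (hammingDist_frameShift_flip hn hpr hp.symm hr.symm _ _)
    (hammingDist_frameShift_flip hn hpq hp.symm hq.symm _ _)
    (triangleDist_hammingDist _ _ _)
    -- This triangle lives in the coordinates over `q.1`, and the next one in those over `r.1`.
    (by
      rw [hammingDist_frameShift_right T hn p.1 q.1]
      have := triangleDist_hammingDist (frameShift T hn q.1 p.1 p.2.2) q.2.2
        (frameShift T hn q.1 r.1 r.2.2)
      exact this)
    (by
      rw [hammingDist_frameShift_right T hn q.1 r.1, hammingDist_frameShift_right T hn p.1 r.1]
      exact triangleDist_hammingDist (frameShift T hn r.1 p.1 p.2.2)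
        (frameShift T hn r.1 q.1 q.2.2) r.2.2)
    (far hqr h₂₃) (far hpr h₁₃) (far hpq h₁₂) hc₁ hc₂ hc₃
  obtain ⟨v, hx, hy, hz⟩ := exists_of_compatible _ _ _ hk b₁ b₂ b₃ hw₃ hw₂ hw₁
  -- Any copy over d serves, since d differs from the three given tournament vertices.
  refine ⟨(d, ⟨0, by omega⟩, v), ?_, ?_, ?_⟩
  · rwa [twistedGraph_adj_iff, linked_of_ne (ne hp)]
  · rwa [twistedGraph_adj_iff, linked_of_ne (ne hq)]
  · rwa [twistedGraph_adj_iff, linked_of_ne (ne hr)]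

/-- Four copies are enough to avoid three. Two tournament vertices provide 2m ≥ 4 of them, so i₁ is
replaced if it equals i₀; if there is only one vertex, then m ≥ 4. -/
theorem exists_free_copy [Finite V] (hm : 2 ≤ m) (hTm : 4 ≤ Nat.card V * m) (i₀ i₁ : V) :
    ∃ i₂, (∀ a, a = i₀ ∨ a = i₁ → a = i₀ ∨ a = i₂) ∧ ∀ c₁ c₂ c₃ : V × Fin m,
      ∃ f : V × Fin m, (f.1 = i₀ ∨ f.1 = i₂) ∧ f ≠ c₁ ∧ f ≠ c₂ ∧ f ≠ c₃ := by
  classical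
  have := Fintype.ofFinite V
  have key : ∀ S : Finset V, 4 ≤ S.card * m → ∀ c₁ c₂ c₃ : V × Fin m,
      ∃ f : V × Fin m, f.1 ∈ S ∧ f ≠ c₁ ∧ f ≠ c₂ ∧ f ≠ c₃ := by
    intro S hS c₁ c₂ c₃
    have hlt : ({c₁, c₂, c₃} : Finset (V × Fin m)).card < (S ×ˢ (Finset.univ : Finset (Fin m))).card := by
      rw [Finset.card_product, Finset.card_fin]
      exact Finset.card_le_three.trans_lt hS
    obtain ⟨f, hf, hf'⟩ := Finset.exists_mem_notMem_of_card_lt_card hlt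
    simp only [Finset.mem_insert, Finset.mem_singleton, not_or] at hf'
    exact ⟨f, (Finset.mem_product.1 hf).1, hf'⟩
  by_cases h : ∃ i₂, i₂ ≠ i₀
  · obtain ⟨i₂, h₂, h⟩ : ∃ i₂, i₂ ≠ i₀ ∧ ∀ a, a = i₀ ∨ a = i₁ → a = i₀ ∨ a = i₂ := by
      by_cases h' : i₁ = i₀
      · obtain ⟨i₂, h₂⟩ := h
        exact ⟨i₂, h₂, fun a ha => Or.inl (by rw [h'] at ha; tauto)⟩
      · exact ⟨i₁, h', fun a ha => ha⟩
    refine ⟨i₂, h, fun c₁ c₂ c₃ => ?_⟩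
    obtain ⟨f, hf, h⟩ := key {i₀, i₂} (by rw [Finset.card_pair h₂.symm]; omega) c₁ c₂ c₃
    exact ⟨f, by simpa using hf, h⟩
  · push Not at h
    refine ⟨i₁, fun a ha => ha, fun c₁ c₂ c₃ => ?_⟩
    obtain ⟨f, -, hf⟩ := key Finset.univ (by rwa [Finset.card_univ, ← Nat.card_eq_fintype_card])
      c₁ c₂ c₃
    exact ⟨f, Or.inl (h _), hf⟩

theorem exists_adj_of_pair [Finite V] (hk : 1 ≤ k) (hm : 2 ≤ m) (hTm : 4 ≤ Nat.card V * m)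
    (p q r : V × Fin m × (Fin (3 * k - 1) → ZMod 2)) {i₀ i₁ : V} (hp : p.1 = i₀ ∨ p.1 = i₁)
    (hq : q.1 = i₀ ∨ q.1 = i₁) (hr : r.1 = i₀ ∨ r.1 = i₁)
    (hpq : b₁ → b₂ → ¬ (twistedGraph T m k hk).Adj p q)
    (hpr : b₁ → b₃ → ¬ (twistedGraph T m k hk).Adj p r)
    (hqr : b₂ → b₃ → ¬ (twistedGraph T m k hk).Adj q r)
    (hpq' : ¬ (b₁ ↔ b₂) → p ≠ q) (hpr' : ¬ (b₁ ↔ b₃) → p ≠ r) (hqr' : ¬ (b₂ ↔ b₃) → q ≠ r) :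
    ∃ v, ((twistedGraph T m k hk).Adj v p ↔ b₁) ∧ ((twistedGraph T m k hk).Adj v q ↔ b₂) ∧
      ((twistedGraph T m k hk).Adj v r ↔ b₃) := by
  have hn := two_le_three_mul_sub_one hk
  obtain ⟨i₂, hi, hf⟩ := exists_free_copy hm hTm i₀ i₁
  obtain ⟨f, hf, hf₁, hf₂, hf₃⟩ := hf (p.1, p.2.1) (q.1, q.2.1) (r.1, r.2.1)
  replace hp := hi _ hp
  replace hq := hi _ hq
  replace hr := hi _ hr
  have ne : ∀ {s t : V × Fin m × (Fin (3 * k - 1) → ZMod 2)}, s ≠ t →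
      (s.1, s.2.1) = (t.1, t.2.1) →
      frameShift T hn i₀ s.1 s.2.2 ≠ frameShift T hn i₀ t.1 t.2.2 := by
    rintro ⟨i, j, x⟩ ⟨i', j', y⟩ h e e'
    obtain ⟨h₁, h₂⟩ := Prod.mk.inj e
    dsimp only at h₁ h₂
    subst h₁ h₂
    exact h (congrArg (fun u => (i, j, u)) ((frameShift T hn i₀ i).injective e'))
  -- In the coordinates over i₀ the twist disappears, and the pairs (tournament vertex, index) serve
  -- as labels of the copies.
  rw [twistedGraph_adj_iff, hammingDist_frameShift_comp hn hp hq] at hpq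
  rw [twistedGraph_adj_iff, hammingDist_frameShift_comp hn hp hr] at hpr
  rw [twistedGraph_adj_iff, hammingDist_frameShift_comp hn hq hr] at hqr
  obtain ⟨c, w, hc, hx, hy, hz⟩ := exists_copy_linked hk hf₁ hf₂ hf₃ hpq hpr hqr
    (fun h => ne (hpq' h)) (fun h => ne (hpr' h)) (fun h => ne (hqr' h))
  have hc' : c.1 = i₀ ∨ c.1 = i₂ := by
    rcases hc with rfl | rfl | rfl | rfl
    exacts [hp, hq, hr, hf]
  have shift : frameShift T hn i₀ c.1 (frameShift T hn c.1 i₀ w) = w := by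
    rw [frameShift_swap T hn c.1 i₀]
    simp
  refine ⟨(c.1, c.2, frameShift T hn c.1 i₀ w), ?_, ?_, ?_⟩
  · rwa [twistedGraph_adj_iff, hammingDist_frameShift_comp hn hc' hp, shift]
  · rwa [twistedGraph_adj_iff, hammingDist_frameShift_comp hn hc' hq, shift]
  · rwa [twistedGraph_adj_iff, hammingDist_frameShift_comp hn hc' hr, shift]

theorem Finset.Nonempty.exists_eq_triple {α : Type*} [DecidableEq α] {A : Finset α}
    (hA : A.Nonempty) (h : A.card ≤ 3) : ∃ a b c, A = {a, b, c} := by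
  have := hA.card_pos
  obtain h | h | h : A.card = 1 ∨ A.card = 2 ∨ A.card = 3 := by omega
  · obtain ⟨a, rfl⟩ := Finset.card_eq_one.1 h
    exact ⟨a, a, a, by simp⟩
  · obtain ⟨a, b, -, rfl⟩ := Finset.card_eq_two.1 h
    exact ⟨a, a, b, by simp⟩
  · obtain ⟨a, b, c, -, -, -, rfl⟩ := Finset.card_eq_three.1 h
    exact ⟨a, b, c, rfl⟩

theorem twistedGraph_isExistentiallyComplete [Finite V] (hT : T.IsShattered) (hm : 2 ≤ m)
    (hk : 1 ≤ k) (hTm : 4 ≤ Nat.card V * m) :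
    (twistedGraph T m k hk).IsExistentiallyComplete 3 := by
  classical
  intro A B hBA hA hB
  rcases A.eq_empty_or_nonempty with rfl | hne
  · obtain rfl := Finset.subset_empty.1 hBA
    -- For empty A any vertex will do, and 4 ≤ |V|·m guarantees that there is one.
    have : Nonempty V := by
      by_contra h
      rw [not_nonempty_iff] at h
      simp at hTm
    exact ⟨(Classical.arbitrary V, ⟨0, by omega⟩, 0), by simp, by simp⟩
  obtain ⟨p, q, r, rfl⟩ := hne.exists_eq_triple hA
  have indep : ∀ s t, s ∈ B → t ∈ B → ¬ (twistedGraph T m k hk).Adj s t :=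
    fun s t hs ht h => hB hs ht h.ne h
  have ne : ∀ {s t}, ¬ (s ∈ B ↔ t ∈ B) → s ≠ t := fun h e => h (by rw [e])
  suffices h : ∃ v, ((twistedGraph T m k hk).Adj v p ↔ p ∈ B) ∧
      ((twistedGraph T m k hk).Adj v q ↔ q ∈ B) ∧ ((twistedGraph T m k hk).Adj v r ↔ r ∈ B) by
    obtain ⟨v, hp, hq, hr⟩ := h
    have hv : ∀ a ∈ ({p, q, r} : Finset _), (twistedGraph T m k hk).Adj v a ↔ a ∈ B := by
      simp [hp, hq, hr]
    exact ⟨v, fun b hb => (hv b (hBA hb)).2 hb, fun a ha hb h => hb ((hv a ha).1 h)⟩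
  rcases exists_pair_or_pairwise_ne p.1 q.1 r.1 with ⟨i₀, i₁, hp, hq, hr⟩ | ⟨h₁₂, h₁₃, h₂₃⟩
  · exact exists_adj_of_pair hk hm hTm p q r hp hq hr (indep p q) (indep p r) (indep q r)
      ne ne ne
  · exact exists_adj_of_pairwise_ne hT hk hm p q r h₁₂ h₁₃ h₂₃ (indep p q) (indep p r) (indep q r)

end

theorem mainTheorem5 {V : Type*} [Finite V] (T : Tournament V) (hT : T.IsShattered)
    (m k : ℕ) (hm : 2 ≤ m) (hk : 1 ≤ k) (hTm : 4 ≤ Nat.card V * m) :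
    (twistedGraph T m k hk).Is3ECTF where
  finite := inferInstance
  triangleFree := twistedGraph_cliqueFree T hk
  existentiallyComplete := twistedGraph_isExistentiallyComplete hT hm hk hTm
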